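/- Let $(M_p)_{p\in\mathbb N}$ be a sequence of positive numbers with $M_0=1$, monotonically increasing to infinity, with $M_p^{1/p}$ ($p\ge 1$) bounded below by a positive constant, and such that (M.1) $M_p^2\le M_{p-1}M_{p+1}$ for $p\ge1$; (M.2) there are $A,H>0$ with $M_{p+q}\le AH^{p+q}M_pM_q$ for all $p,q\ge 0$; (M.3)$'$ $\sum_{p\ge1}M_{p-1}/M_p<\infty$. Let $M(\rho)=\sup_{p}\ln_+(\rho^p M_0/M_p)$ be its associated function. Let $X\subseteq\mathbb R^d$ be open. $\mathcal D^{(M_p)}(X)$ is the space of all $\varphi\in C^\infty(\mathbb{R}^d)$ with compact support contained in $X$ such that $\sup_{\alpha,x}A^{|\alpha|}M_{|\alpha|}^{-1}|\partial^\alpha\varphi(x)|<\infty$ for every $A>0$, with its usual inductive limit topology, and $(\mathcal D^{(M_p)})'(X)$ is its dual. For $f\in(\mathcal D^{(M_p)})'(X)$ and $\varphi\in\mathcal D^{(M_p)}(X)$ the product $\varphi f$ is given by $\langle \varphi f,\psi\rangle=\langle f,\varphi\psi\rangle$, and $\widehat{\varphi f}(\xi)=\langle f,\varphi\, e^{-2\pi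 i\langle\cdot,\xi\rangle}\rangle$. Let $\mathcal M_{M(\rho)}(\mathbb R^{2d})$ be the set of all non-negative $\omega\in L^\infty_{loc}(\mathbb R^{2d})$ for which there is $C>0$ with $\omega(z+w)\le C e^{M(|z|)}\omega(w)$ for all $z,w\in\mathbb R^{2d}$. For $q\in[1,\infty]$, $\omega\in\mathcal M_{M(\rho)}(\mathbb R^{2d})$ and a fixed $x\in\mathbb R^d$, the wave-front set $\mathrm{WF}_{\mathcal FL^q_{(\omega)}}(f)$ of $f\in(\mathcal D^{(M_p)})'(X)$ is the set of all $(x_0,\xi_0)\in X\times(\mathbb R^d\setminus 0)$ such that for every $\varphi\in\mathcal D^{(M_p)}(X)$ with $\varphi(x_0)\ne0$ and every open cone $\Gamma\subseteq\mathbb R^d\setminus0$ containing $\xi_0$, $$\Big(\int_\Gamma|\widehat{\varphi f}(\xi)\,\omega(x,\xi)|^q\,d\xi\Big)^{1/q}=\infty$$ (with the essential supremum over $\Gamma$ if $q=\infty$). Let $1\le r\le q\le\infty$ and let $\omega,\vartheta\in\mathcal M_{M(\rho)}(\mathbb R^{2d})$ satisfy $\omega\le c\,\vartheta$ for some constant $c>0$.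 Then for all $f\in(\mathcal D^{(M_p)})'(X)$ and $\varphi\in\mathcal D^{(M_p)}(X)$, and whichever points $x$ are used in the definition of the wave-front sets on the two sides, $$\mathrm{WF}_{\mathcal FL^q_{(\omega)}}(\varphi f)\subseteq\mathrm{WF}_{\mathcal FL^r_{(\vartheta)}}(f).$$ Moreover these wave-front sets are microlocal, $\mathrm{WF}_{\mathcal FL^q_{(\omega)}}(\varphi f)\subseteq\mathrm{WF}_{\mathcal FL^q_{(\omega)}}(f)$, decrease in the exponent, $\mathrm{WF}_{\mathcal FL^q_{(\omega)}}(f)\subseteq\mathrm{WF}_{\mathcal FL^r_{(\omega)}}(f)$, and increase in the weight, $\mathrm{WF}_{\mathcal FL^q_{(\omega)}}(f)\subseteq\mathrm{WF}_{\mathcal FL^q_{(\vartheta)}}(f)$. -/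

import Mathlib

open Set Filter Topology MeasureTheory
open scoped ENNReal NNReal

namespace UltraWF

noncomputable section

/-- The Euclidean space `ℝ^d`. -/
abbrev Rd (d : ℕ) := EuclideanSpace ℝ (Fin d)

/-! ### Weight sequences and associated functions -/

/-- A sequence `(M_p)` of positive numbers, `M_0 = 1`, monotonically increasing to infinity, with
`M_p^{1/p}` bounded below by a positive constant, which satisfies the conditions
(M.1), (M.2) and (M.3)'. -/
structure KomatsuSeq where
  seq : ℕ → ℝ
  pos : ∀ p, 0 < seq p
  zero_eq_one : seq 0 = 1
  monotone : Monotone seq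
  tendsto_atTop : Tendsto seq atTop atTop
  root_bddBelow : ∃ c : ℝ, 0 < c ∧ ∀ p : ℕ, 1 ≤ p → c ≤ seq p ^ ((1 : ℝ) / (p : ℝ))
  /-- Condition (M.1): logarithmic convexity. -/
  m1 : ∀ p, seq (p + 1) ^ 2 ≤ seq p * seq (p + 2)
  /-- Condition (M.2): stability under ultradifferential operators. -/
  m2 : ∃ A H : ℝ, 0 < A ∧ 0 < H ∧ ∀ p q, seq (p + q) ≤ A * H ^ (p + q) * seq p * seq q
  /-- Condition (M.3)': non-quasianalyticity. -/
  m3' : Summable fun p => seq p / seq (p + 1)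

/-- The associated function `M(ρ) = sup_p ln_+ (ρ^p M_0 / M_p)`. -/
def KomatsuSeq.assoc (M : KomatsuSeq) (ρ : ℝ) : ℝ :=
  ⨆ p : ℕ, Real.posLog (ρ ^ p * M.seq 0 / M.seq p)

/-! ### Weights on `ℝ^{2d}` -/

/-- `ω` is a weight on `ℝ^{2d} = ℝ^d × ℝ^d` (a non-negative function in `L^∞_loc`) which is moderate
with respect to `e^{M(|·|)}`, where `|(x, ξ)| = (|x|² + |ξ|²)^{1/2}` is the Euclidean norm. -/
structure IsModerateWeight {d : ℕ} (M : KomatsuSeq) (ω : Rd d × Rd d → ℝ) : Prop where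
  nonneg : ∀ z, 0 ≤ ω z
  locBounded : ∀ K : Set (Rd d × Rd d), IsCompact K → MemLp ω ⊤ (volume.restrict K)
  moderate : ∃ C : ℝ, 0 < C ∧ ∀ z w : Rd d × Rd d,
    ω (z + w) ≤ C * Real.exp (M.assoc (Real.sqrt (‖z.1‖ ^ 2 + ‖z.2‖ ^ 2))) * ω w

/-- `ω ≲ ϑ`: there is a constant `c > 0` with `ω ≤ c ϑ` everywhere. -/
def WeightLE {d : ℕ} (ω ϑ : Rd d × Rd d → ℝ) : Prop :=
  ∃ c : ℝ, 0 < c ∧ ∀ z, ω z ≤ c * ϑ z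

/-! ### Ultradifferentiable test functions -/

/-- The partial derivative `∂_{j_1} ⋯ ∂_{j_n} φ (x)`. As `j` runs over `Fin n → Fin d`, these are
exactly the derivatives `∂^p φ (x)`, `p` a multi-index with `|p| = n`. -/
def mixedPartial {d : ℕ} (φ : Rd d → ℂ) (n : ℕ) (j : Fin n → Fin d) (x : Rd d) : ℂ :=
  iteratedFDeriv ℝ n φ x fun i => EuclideanSpace.single (j i) 1

/-- The norm `‖φ‖_{M_p, A, K} = sup_p sup_{x ∈ K} A^{|p|} / M_{|p|} |∂^p φ (x)|`, possibly `∞`. -/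
def ultraNorm {d : ℕ} (M : KomatsuSeq) (A : ℝ) (K : Set (Rd d)) (φ : Rd d → ℂ) : ℝ≥0∞ :=
  ⨆ (n : ℕ) (j : Fin n → Fin d) (x ∈ K),
    ENNReal.ofReal (A ^ n / M.seq n) * ‖mixedPartial φ n j x‖ₑ

lemma mixedPartial_add {d : ℕ} {φ ψ : Rd d → ℂ} (hφ : ContDiff ℝ (⊤ : ℕ∞) φ) (hψ : ContDiff ℝ (⊤ : ℕ∞) ψ)
    (n : ℕ) (j : Fin n → Fin d) (x : Rd d) :
    mixedPartial (φ + ψ) n j x = mixedPartial φ n j x + mixedPartial ψ n j x := by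
  unfold mixedPartial
  rw [iteratedFDeriv_add_apply (hφ.contDiffAt.of_le (by exact_mod_cast le_top))
    (hψ.contDiffAt.of_le (by exact_mod_cast le_top))]
  rfl

lemma mixedPartial_smul {d : ℕ} {φ : Rd d → ℂ} (hφ : ContDiff ℝ (⊤ : ℕ∞) φ) (c : ℂ)
    (n : ℕ) (j : Fin n → Fin d) (x : Rd d) :
    mixedPartial (c • φ) n j x = c * mixedPartial φ n j x := by
  unfold mixedPartial
  rw [iteratedFDeriv_const_smul_apply (hφ.contDiffAt.of_le (by exact_mod_cast le_top))]
  rfl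

lemma ultraNorm_add_le {d : ℕ} (M : KomatsuSeq) (A : ℝ) (K : Set (Rd d)) {φ ψ : Rd d → ℂ}
    (hφ : ContDiff ℝ (⊤ : ℕ∞) φ) (hψ : ContDiff ℝ (⊤ : ℕ∞) ψ) :
    ultraNorm M A K (φ + ψ) ≤ ultraNorm M A K φ + ultraNorm M A K ψ := by
  refine iSup_le fun n => iSup_le fun j => iSup₂_le fun x hx => ?_
  rw [mixedPartial_add hφ hψ]
  refine (mul_le_mul_right (enorm_add_le _ _) _).trans ?_
  rw [mul_add]
  refine add_le_add ?_ ?_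
  · exact le_iSup_of_le n (le_iSup_of_le j (le_iSup₂_of_le x hx le_rfl))
  · exact le_iSup_of_le n (le_iSup_of_le j (le_iSup₂_of_le x hx le_rfl))

lemma ultraNorm_smul_le {d : ℕ} (M : KomatsuSeq) (A : ℝ) (K : Set (Rd d)) {φ : Rd d → ℂ}
    (hφ : ContDiff ℝ (⊤ : ℕ∞) φ) (c : ℂ) :
    ultraNorm M A K (c • φ) ≤ ‖c‖ₑ * ultraNorm M A K φ := by
  refine iSup_le fun n => iSup_le fun j => iSup₂_le fun x hx => ?_
  rw [mixedPartial_smul hφ, enorm_mul, mul_left_comm]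
  refine mul_le_mul_right ?_ _
  exact le_iSup_of_le n (le_iSup_of_le j (le_iSup₂_of_le x hx le_rfl))

lemma ultraNorm_zero {d : ℕ} (M : KomatsuSeq) (A : ℝ) (K : Set (Rd d)) :
    ultraNorm M A K (0 : Rd d → ℂ) = 0 := by
  have h := ultraNorm_smul_le M A K (φ := (0 : Rd d → ℂ)) contDiff_const 0
  simpa using h

/-- The space `𝓔^{(M_p)}(ℝ^d)` of ultradifferentiable functions of Beurling type: smooth functions
with `‖φ‖_{M_p, A, K} < ∞` for every compact `K` and every `A > 0`. -/
def BeurlingE (M : KomatsuSeq) (d : ℕ) : Submodule ℂ (Rd d → ℂ) where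
  carrier := {φ | ContDiff ℝ (⊤ : ℕ∞) φ ∧
    ∀ K : Set (Rd d), IsCompact K → ∀ A : ℝ, 0 < A → ultraNorm M A K φ < ⊤}
  add_mem' := by
    rintro φ ψ ⟨hφ, hφ'⟩ ⟨hψ, hψ'⟩
    refine ⟨hφ.add hψ, fun K hK A hA => (ultraNorm_add_le M A K hφ hψ).trans_lt ?_⟩
    exact ENNReal.add_lt_top.2 ⟨hφ' K hK A hA, hψ' K hK A hA⟩
  zero_mem' := ⟨contDiff_const, fun K _ A _ => by rw [ultraNorm_zero]; exact ENNReal.zero_lt_top⟩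
  smul_mem' := by
    rintro c φ ⟨hφ, hφ'⟩
    refine ⟨contDiff_const.smul hφ, fun K hK A hA => (ultraNorm_smul_le M A K hφ c).trans_lt ?_⟩
    exact ENNReal.mul_lt_top enorm_lt_top (hφ' K hK A hA)

/-- The space `𝓓^{(M_p)}(X)`: the elements of `𝓔^{(M_p)}` with compact support contained in `X`
(extended by zero outside `X`). -/
def BeurlingD (M : KomatsuSeq) {d : ℕ} (X : Set (Rd d)) : Submodule ℂ (Rd d → ℂ) where
  carrier := {φ | φ ∈ BeurlingE M d ∧ HasCompactSupport φ ∧ tsupport φ ⊆ X}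
  add_mem' := by
    rintro φ ψ ⟨hφ, hφc, hφX⟩ ⟨hψ, hψc, hψX⟩
    refine ⟨add_mem hφ hψ, hφc.add hψc, (tsupport_add φ ψ).trans (union_subset hφX hψX)⟩
  zero_mem' := by
    refine ⟨zero_mem _, HasCompactSupport.zero, ?_⟩
    simp [tsupport]
  smul_mem' := by
    rintro c φ ⟨hφ, hφc, hφX⟩
    have h : tsupport (c • φ) ⊆ tsupport φ := closure_mono (Function.support_const_smul_subset c φ)
    exact ⟨Submodule.smul_mem _ c hφ, hφc.mono (Function.support_const_smul_subset c φ),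
      h.trans hφX⟩

/-! ### Products and exponentials are ultradifferentiable -/

lemma KomatsuSeq.mul_le (M : KomatsuSeq) (k l : ℕ) :
    M.seq k * M.seq l ≤ M.seq (k + l) := by
  have step : ∀ p, M.seq (p + 1) / M.seq p ≤ M.seq (p + 2) / M.seq (p + 1) := fun p => by
    rw [div_le_div_iff₀ (M.pos _) (M.pos _)]
    nlinarith [M.m1 p]
  have mono : Monotone fun p => M.seq (p + 1) / M.seq p := monotone_nat_of_le_succ step
  induction l with
  | zero => simp [M.zero_eq_one]
  | succ l ih =>
    have h := mono (Nat.le_add_left l k)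
    have hl := M.pos l
    have hkl := M.pos (k + l)
    have h' : M.seq (l + 1) * M.seq (k + l) ≤ M.seq (k + l + 1) * M.seq l :=
      (div_le_div_iff₀ hl hkl).1 h
    have h1 := mul_le_mul_of_nonneg_left ih (M.pos (l + 1)).le
    have h2 : M.seq l * (M.seq k * M.seq (l + 1)) ≤ M.seq l * M.seq (k + (l + 1)) := by
      rw [← add_assoc]
      nlinarith
    exact le_of_mul_le_mul_left h2 hl

lemma enorm_mixedPartial_le {d : ℕ} (φ : Rd d → ℂ) (n : ℕ) (j : Fin n → Fin d) (x : Rd d) :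
    ‖mixedPartial φ n j x‖ ≤ ‖iteratedFDeriv ℝ n φ x‖ := by
  refine ((iteratedFDeriv ℝ n φ x).le_opNorm _).trans ?_
  simp

/-- The norm of an iterated derivative is controlled by the partial derivatives. -/
lemma norm_iteratedFDeriv_le {d : ℕ} (φ : Rd d → ℂ) (n : ℕ) (x : Rd d) {B : ℝ} (hB : 0 ≤ B)
    (h : ∀ j : Fin n → Fin d, ‖mixedPartial φ n j x‖ ≤ B) :
    ‖iteratedFDeriv ℝ n φ x‖ ≤ ((d : ℝ) + 1) ^ n * B := by
  refine ContinuousMultilinearMap.opNorm_le_bound (by positivity) fun v => ?_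
  have hv : ∀ i, v i = ∑ k : Fin d, (v i k) • (EuclideanSpace.single k (1 : ℝ) : Rd d) := by
    intro i
    ext l
    simp [Pi.single_apply]
  have h1 : iteratedFDeriv ℝ n φ x v = ∑ j : Fin n → Fin d,
      (∏ i, v i (j i)) • mixedPartial φ n j x := by
    conv_lhs => rw [show v = fun i => ∑ k : Fin d,
      (v i k) • (EuclideanSpace.single k (1 : ℝ) : Rd d) from funext hv]
    rw [ContinuousMultilinearMap.map_sum]
    refine Finset.sum_congr rfl fun j _ => ?_
    rw [ContinuousMultilinearMap.map_smul_univ]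
    rfl
  rw [h1]
  calc ‖∑ j : Fin n → Fin d, (∏ i, v i (j i)) • mixedPartial φ n j x‖
      ≤ ∑ j : Fin n → Fin d, (∏ i, ‖v i‖) * B := by
        refine norm_sum_le_of_le _ fun j _ => ?_
        rw [norm_smul, norm_prod]
        refine mul_le_mul ?_ (h j) (norm_nonneg _) (Finset.prod_nonneg fun i _ => norm_nonneg _)
        exact Finset.prod_le_prod (fun i _ => norm_nonneg _) fun i _ => PiLp.norm_apply_le (v i) _
    _ = (d : ℝ) ^ n * B * ∏ i, ‖v i‖ := by
        simp [Finset.sum_const, Finset.card_univ]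
        ring
    _ ≤ ((d : ℝ) + 1) ^ n * B * ∏ i, ‖v i‖ := by
        have : (d : ℝ) ^ n ≤ ((d : ℝ) + 1) ^ n := by gcongr; linarith
        have h0 : 0 ≤ ∏ i, ‖v i‖ := Finset.prod_nonneg fun i _ => norm_nonneg _
        gcongr

lemma norm_iteratedFDeriv_le_ultraNorm {d : ℕ} (M : KomatsuSeq) {A : ℝ} (hA : 0 < A)
    {K : Set (Rd d)} {φ : Rd d → ℂ} (h : ultraNorm M (((d : ℝ) + 1) * A) K φ < ⊤) (n : ℕ)
    {x : Rd d} (hx : x ∈ K) :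
    ‖iteratedFDeriv ℝ n φ x‖ ≤
      M.seq n / A ^ n * (ultraNorm M (((d : ℝ) + 1) * A) K φ).toReal := by
  set S := ultraNorm M (((d : ℝ) + 1) * A) K φ with hS
  have hMn := M.pos n
  have hd : (0 : ℝ) < (d : ℝ) + 1 := by positivity
  refine (norm_iteratedFDeriv_le φ n x (B := M.seq n / (((d : ℝ) + 1) * A) ^ n * S.toReal)
    (by positivity) fun j => ?_).trans (le_of_eq ?_)
  · have h1 : ENNReal.ofReal ((((d : ℝ) + 1) * A) ^ n / M.seq n) * ‖mixedPartial φ n j x‖ₑ ≤ S :=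
      le_iSup_of_le n (le_iSup_of_le j (le_iSup₂_of_le x hx le_rfl))
    have h2 := ENNReal.toReal_mono h.ne h1
    rw [ENNReal.toReal_mul, ENNReal.toReal_ofReal (by positivity), toReal_enorm] at h2
    rw [div_mul_eq_mul_div, le_div_iff₀ (by positivity)]
    rw [div_mul_eq_mul_div, div_le_iff₀ hMn] at h2
    linarith
  · rw [mul_pow]
    field_simp

lemma ultraNorm_le_of_iteratedFDeriv {d : ℕ} (M : KomatsuSeq) {A : ℝ} (hA : 0 < A)
    {K : Set (Rd d)} {φ : Rd d → ℂ} {B : ℝ}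
    (h : ∀ n, ∀ x ∈ K, ‖iteratedFDeriv ℝ n φ x‖ ≤ M.seq n / A ^ n * B) :
    ultraNorm M A K φ ≤ ENNReal.ofReal B := by
  refine iSup_le fun n => iSup_le fun j => iSup₂_le fun x hx => ?_
  have hMn := M.pos n
  rw [← ofReal_norm, ← ENNReal.ofReal_mul (by positivity)]
  refine ENNReal.ofReal_le_ofReal ?_
  have h1 := (enorm_mixedPartial_le φ n j x).trans (h n x hx)
  calc A ^ n / M.seq n * ‖mixedPartial φ n j x‖
      ≤ A ^ n / M.seq n * (M.seq n / A ^ n * B) := by gcongr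
    _ = B := by field_simp

lemma ultraNorm_mul_le {d : ℕ} (M : KomatsuSeq) {A : ℝ} (hA : 0 < A) (K : Set (Rd d))
    {φ ψ : Rd d → ℂ} (hφ : ContDiff ℝ (⊤ : ℕ∞) φ) (hψ : ContDiff ℝ (⊤ : ℕ∞) ψ)
    (hφ' : ultraNorm M (((d : ℝ) + 1) * (2 * A)) K φ < ⊤)
    (hψ' : ultraNorm M (((d : ℝ) + 1) * (2 * A)) K ψ < ⊤) :
    ultraNorm M A K (φ * ψ) ≤ ultraNorm M (((d : ℝ) + 1) * (2 * A)) K φ *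
      ultraNorm M (((d : ℝ) + 1) * (2 * A)) K ψ := by
  set a := (ultraNorm M (((d : ℝ) + 1) * (2 * A)) K φ).toReal with ha
  set b := (ultraNorm M (((d : ℝ) + 1) * (2 * A)) K ψ).toReal with hb
  have ha0 : 0 ≤ a := ENNReal.toReal_nonneg
  have hb0 : 0 ≤ b := ENNReal.toReal_nonneg
  rw [← ENNReal.ofReal_toReal hφ'.ne, ← ENNReal.ofReal_toReal hψ'.ne, ← ha, ← hb,
    ← ENNReal.ofReal_mul ha0]
  refine ultraNorm_le_of_iteratedFDeriv M hA fun n x hx => ?_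
  refine (norm_iteratedFDeriv_mul_le hφ hψ x (n := n) (by exact_mod_cast le_top)).trans ?_
  have h2A : 0 < 2 * A := by positivity
  have key : ∀ i ∈ Finset.range (n + 1),
      (n.choose i : ℝ) * ‖iteratedFDeriv ℝ i φ x‖ * ‖iteratedFDeriv ℝ (n - i) ψ x‖ ≤
        (n.choose i : ℝ) * (M.seq n / (2 * A) ^ n * (a * b)) := by
    intro i hi
    have hin : i + (n - i) = n := by have := Finset.mem_range.1 hi; omega
    rw [mul_assoc]
    refine mul_le_mul_of_nonneg_left ?_ (Nat.cast_nonneg _)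
    have hMi := M.pos i
    have hMni := M.pos (n - i)
    calc ‖iteratedFDeriv ℝ i φ x‖ * ‖iteratedFDeriv ℝ (n - i) ψ x‖
        ≤ (M.seq i / (2 * A) ^ i * a) * (M.seq (n - i) / (2 * A) ^ (n - i) * b) :=
          mul_le_mul (norm_iteratedFDeriv_le_ultraNorm M h2A hφ' i hx)
            (norm_iteratedFDeriv_le_ultraNorm M h2A hψ' (n - i) hx) (norm_nonneg _)
            (by positivity)
      _ = (M.seq i * M.seq (n - i)) / (2 * A) ^ (i + (n - i)) * (a * b) := by
          rw [pow_add]; field_simp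
      _ ≤ M.seq n / (2 * A) ^ n * (a * b) := by
          have := M.mul_le i (n - i)
          rw [hin] at this ⊢
          gcongr
  refine (Finset.sum_le_sum key).trans (le_of_eq ?_)
  rw [← Finset.sum_mul, ← Nat.cast_sum, Nat.sum_range_choose, mul_pow]
  push_cast
  field_simp

lemma BeurlingE.mul_mem {M : KomatsuSeq} {d : ℕ} {φ ψ : Rd d → ℂ} (hφ : φ ∈ BeurlingE M d)
    (hψ : ψ ∈ BeurlingE M d) : φ * ψ ∈ BeurlingE M d := by
  refine ⟨hφ.1.mul hψ.1, fun K hK A hA => ?_⟩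
  have h1 := hφ.2 K hK (((d : ℝ) + 1) * (2 * A)) (by positivity)
  have h2 := hψ.2 K hK (((d : ℝ) + 1) * (2 * A)) (by positivity)
  exact (ultraNorm_mul_le M hA K hφ.1 hψ.1 h1 h2).trans_lt (ENNReal.mul_lt_top h1 h2)

lemma BeurlingD.mul_mem {M : KomatsuSeq} {d : ℕ} {X : Set (Rd d)} {φ ψ : Rd d → ℂ}
    (hφ : φ ∈ BeurlingD M X) (hψ : ψ ∈ BeurlingE M d) : φ * ψ ∈ BeurlingD M X :=
  ⟨BeurlingE.mul_mem hφ.1 hψ, hφ.2.1.mul_right, tsupport_mul_subset_left.trans hφ.2.2⟩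

/-- The exponential `x ↦ e^{-2πi x·ξ}`. -/
def expFun {d : ℕ} (ξ : Rd d) (x : Rd d) : ℂ :=
  Complex.exp (((-2 * Real.pi * inner ℝ x ξ : ℝ) : ℂ) * Complex.I)

lemma norm_iteratedFDeriv_expFun_le {d : ℕ} (ξ : Rd d) (n : ℕ) (x : Rd d) :
    ‖iteratedFDeriv ℝ n (expFun ξ) x‖ ≤ ‖(-2 * Real.pi) • innerSL ℝ ξ‖ ^ n := by
  set L : Rd d →L[ℝ] ℝ := (-2 * Real.pi) • innerSL ℝ ξ with hL
  let g : ℝ → ℂ := fun t => Complex.exp ((t : ℂ) * Complex.I)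
  have hg : ContDiff ℝ (⊤ : ℕ∞) g := by
    have : ContDiff ℝ (⊤ : ℕ∞) (fun t : ℝ => (t : ℂ)) := Complex.ofRealCLM.contDiff
    exact (this.mul contDiff_const).cexp
  have hfun : expFun ξ = g ∘ L := by
    funext y
    simp [expFun, g, hL, real_inner_comm]
  have hderiv : deriv g = fun t => Complex.I * g t := by
    funext t
    have h1 : HasDerivAt (fun t : ℝ => (t : ℂ) * Complex.I) (1 * Complex.I) t :=
      (Complex.ofRealCLM.hasDerivAt (x := t)).mul_const Complex.I
    have h2 := h1.cexp
    rw [h2.deriv]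
    simp [g, mul_comm]
  have hit : ∀ m : ℕ, iteratedDeriv m g = fun t => Complex.I ^ m * g t := by
    intro m
    induction m with
    | zero => simp
    | succ m ih =>
      rw [iteratedDeriv_succ, ih]
      funext t
      have hd : DifferentiableAt ℝ g t := (hg.differentiable (by simp)).differentiableAt
      rw [deriv_const_mul _ hd, hderiv, pow_succ, mul_assoc]
  rw [hfun, ContinuousLinearMap.iteratedFDeriv_comp_right L hg x (by exact_mod_cast le_top)]
  refine (ContinuousMultilinearMap.norm_compContinuousLinearMap_le _ _).trans ?_
  rw [norm_iteratedFDeriv_eq_norm_iteratedDeriv, hit n]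
  simp [g, Complex.norm_exp_ofReal_mul_I]

lemma KomatsuSeq.exists_pow_le (M : KomatsuSeq) (B : ℝ) :
    ∃ C : ℝ, ∀ n, B ^ n ≤ M.seq n * C := by
  have h0 : Tendsto (fun n => |B| * (M.seq n / M.seq (n + 1))) atTop (𝓝 0) := by
    simpa using M.m3'.tendsto_atTop_zero.const_mul |B|
  have hs : Summable fun n => B ^ n / M.seq n := by
    by_cases hB : B = 0
    · subst hB
      refine summable_of_ne_finset_zero (s := {0}) fun n hn => ?_
      have : n ≠ 0 := by simpa using hn
      simp [this]
    refine summable_of_ratio_test_tendsto_lt_one (l := 0) one_pos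
      (Eventually.of_forall fun n => div_ne_zero (pow_ne_zero _ hB) (M.pos n).ne') ?_
    refine h0.congr fun n => ?_
    have h1 := M.pos n
    have h2 := M.pos (n + 1)
    have h3 : |B| ≠ 0 := abs_ne_zero.2 hB
    rw [Real.norm_eq_abs, Real.norm_eq_abs, abs_div, abs_div, abs_of_pos h1, abs_of_pos h2,
      abs_pow, abs_pow, pow_succ]
    field_simp
  obtain ⟨C, hC⟩ := hs.tendsto_atTop_zero.bddAbove_range
  refine ⟨C, fun n => ?_⟩
  have := hC ⟨n, rfl⟩
  rw [div_le_iff₀ (M.pos n)] at this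
  linarith

lemma expFun_mem (M : KomatsuSeq) {d : ℕ} (ξ : Rd d) : expFun ξ ∈ BeurlingE M d := by
  constructor
  · have h1 : ContDiff ℝ (⊤ : ℕ∞) (fun x : Rd d => (-2 * Real.pi * inner ℝ x ξ : ℝ)) :=
      contDiff_const.mul (contDiff_id.inner ℝ contDiff_const)
    have h2 : ContDiff ℝ (⊤ : ℕ∞) (fun x : Rd d => ((-2 * Real.pi * inner ℝ x ξ : ℝ) : ℂ)) :=
      Complex.ofRealCLM.contDiff.comp h1
    exact (h2.mul contDiff_const).cexp
  · intro K _ A hA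
    obtain ⟨C, hC⟩ := M.exists_pow_le (A * ‖(-2 * Real.pi) • innerSL ℝ ξ‖)
    refine (ultraNorm_le_of_iteratedFDeriv M hA (B := C) fun n x _ => ?_).trans_lt
      ENNReal.ofReal_lt_top
    refine (norm_iteratedFDeriv_expFun_le ξ n x).trans ?_
    rw [div_mul_eq_mul_div, le_div_iff₀ (by positivity), mul_comm, ← mul_pow]
    exact hC n

/-! ### Ultradistributions -/

/-- The space `(𝓓^{(M_p)})'(X)` of ultradistributions of Beurling type: the continuous linear
functionals on the inductive limit `𝓓^{(M_p)}(X)`, i.e. the linear functionals whose restriction to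
each `𝓓^{(M_p)}_K`, `K ⊆ X` compact, is bounded by a multiple of some norm `‖·‖_{M_p, A, K}`. -/
structure Ultradistribution (M : KomatsuSeq) {d : ℕ} (X : Set (Rd d)) where
  toLin : BeurlingD M X →ₗ[ℂ] ℂ
  cont : ∀ K : Set (Rd d), IsCompact K → K ⊆ X → ∃ A : ℝ, 0 < A ∧ ∃ C : ℝ≥0,
    ∀ ψ : BeurlingD M X, tsupport (ψ : Rd d → ℂ) ⊆ K →
      ‖toLin ψ‖ₑ ≤ (C : ℝ≥0∞) * ultraNorm M A K (ψ : Rd d → ℂ)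

/-- The space `(𝓔^{(M_p)})'(ℝ^d)` of ultradistributions of Beurling type with compact support: the
continuous linear functionals on `𝓔^{(M_p)}(ℝ^d)`. -/
structure CompactUltradistribution (M : KomatsuSeq) (d : ℕ) where
  toLin : BeurlingE M d →ₗ[ℂ] ℂ
  cont : ∃ K : Set (Rd d), IsCompact K ∧ ∃ A : ℝ, 0 < A ∧ ∃ C : ℝ≥0,
    ∀ ψ : BeurlingE M d, ‖toLin ψ‖ₑ ≤ (C : ℝ≥0∞) * ultraNorm M A K (ψ : Rd d → ℂ)

/-- The product `φ f ∈ (𝓓^{(M_p)})'(X)` of a test function and an ultradistribution,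
`⟨φ f, ψ⟩ = ⟨f, φ ψ⟩` for `ψ ∈ 𝓓^{(M_p)}(X)`. -/
def Ultradistribution.mulTest {M : KomatsuSeq} {d : ℕ} {X : Set (Rd d)} (φ : BeurlingD M X)
    (f : Ultradistribution M X) : Ultradistribution M X where
  toLin :=
    { toFun := fun ψ => f.toLin ⟨(φ : Rd d → ℂ) * ψ, BeurlingD.mul_mem φ.2 ψ.2.1⟩
      map_add' := fun ψ₁ ψ₂ => by
        rw [← map_add]; congr 1; ext1; exact mul_add _ _ _
      map_smul' := fun c ψ => by
        rw [RingHom.id_apply, ← map_smul]; congr 1; ext1; exact mul_smul_comm c _ _ }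
  cont := by
    intro K hK hKX
    obtain ⟨A, hA, C, hC⟩ := f.cont K hK hKX
    have hA' : 0 < ((d : ℝ) + 1) * (2 * A) := by positivity
    have hφ := φ.2.1.2 K hK _ hA'
    refine ⟨_, hA', C * (ultraNorm M (((d : ℝ) + 1) * (2 * A)) K (φ : Rd d → ℂ)).toNNReal, fun ψ hψ => ?_⟩
    refine (hC _ (tsupport_mul_subset_right.trans hψ)).trans ?_
    rw [ENNReal.coe_mul, ENNReal.coe_toNNReal hφ.ne, mul_assoc]
    exact mul_le_mul_right (ultraNorm_mul_le M hA K φ.2.1.1 ψ.2.1.1 hφ (ψ.2.1.2 K hK _ hA')) _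

/-- The same product `φ f`, as an ultradistribution with compact support on `ℝ^d`,
`⟨φ f, ψ⟩ = ⟨f, φ ψ⟩` for `ψ ∈ 𝓔^{(M_p)}(ℝ^d)`. -/
def Ultradistribution.cutoff {M : KomatsuSeq} {d : ℕ} {X : Set (Rd d)} (φ : BeurlingD M X)
    (f : Ultradistribution M X) : CompactUltradistribution M d where
  toLin :=
    { toFun := fun ψ => f.toLin ⟨(φ : Rd d → ℂ) * ψ, BeurlingD.mul_mem φ.2 ψ.2⟩
      map_add' := fun ψ₁ ψ₂ => by
        rw [← map_add]; congr 1; ext1; exact mul_add _ _ _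
      map_smul' := fun c ψ => by
        rw [RingHom.id_apply, ← map_smul]; congr 1; ext1; exact mul_smul_comm c _ _ }
  cont := by
    have hK : IsCompact (tsupport (φ : Rd d → ℂ)) := φ.2.2.1
    obtain ⟨A, hA, C, hC⟩ := f.cont _ hK φ.2.2.2
    have hA' : 0 < ((d : ℝ) + 1) * (2 * A) := by positivity
    have hφ := φ.2.1.2 _ hK _ hA'
    refine ⟨_, hK, _, hA', C * (ultraNorm M (((d : ℝ) + 1) * (2 * A))
      (tsupport (φ : Rd d → ℂ)) (φ : Rd d → ℂ)).toNNReal, fun ψ => ?_⟩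
    refine (hC _ tsupport_mul_subset_left).trans ?_
    rw [ENNReal.coe_mul, ENNReal.coe_toNNReal hφ.ne, mul_assoc]
    exact mul_le_mul_right (ultraNorm_mul_le M hA _ φ.2.1.1 ψ.2.1 hφ (ψ.2.2 _ hK _ hA')) _

/-- The Fourier transform of a compactly supported ultradistribution `u`, which is the function
`û(ξ) = ⟨u, e^{-2πi ⟨·, ξ⟩}⟩`. -/
def CompactUltradistribution.fourier {M : KomatsuSeq} {d : ℕ} (u : CompactUltradistribution M d)
    (ξ : Rd d) : ℂ :=
  u.toLin ⟨expFun ξ, expFun_mem M ξ⟩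

/-! ### Wave-front sets of Fourier–Lebesgue type -/

/-- `Γ` is an open cone in `ℝ^d ∖ 0`. -/
structure IsOpenCone {d : ℕ} (Γ : Set (Rd d)) : Prop where
  isOpen : IsOpen Γ
  zero_notMem : (0 : Rd d) ∉ Γ
  smul_mem : ∀ t : ℝ, 0 < t → ∀ ξ ∈ Γ, t • ξ ∈ Γ

/-- The seminorm `|u|_{𝓕L^{q,Γ}_{(ω), x}} = (∫_Γ |û(ξ) ω(x, ξ)|^q dξ)^{1/q}`, with the essential
supremum over `Γ` when `q = ∞`; its value may be `∞`. -/
def flSeminorm {M : KomatsuSeq} {d : ℕ} (q : ℝ≥0∞) (ω : Rd d × Rd d → ℝ) (x : Rd d)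
    (Γ : Set (Rd d)) (u : CompactUltradistribution M d) : ℝ≥0∞ :=
  eLpNorm (fun ξ => u.fourier ξ * (ω (x, ξ) : ℂ)) q (volume.restrict Γ)

/-- `Θ_𝓑(u)`, `𝓑 = 𝓕L^q_{(ω)}`: the `ξ ≠ 0` which have an open conical neighbourhood `Γ` with
`|u|_{𝓑(Γ)} < ∞`. -/
def ThetaSet {M : KomatsuSeq} {d : ℕ} (q : ℝ≥0∞) (ω : Rd d × Rd d → ℝ) (x : Rd d)
    (u : CompactUltradistribution M d) : Set (Rd d) :=
  {ξ | ξ ≠ 0 ∧ ∃ Γ : Set (Rd d), IsOpenCone Γ ∧ ξ ∈ Γ ∧ flSeminorm q ω x Γ u < ⊤}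

/-- `Σ_𝓑(u)`: the complement of `Θ_𝓑(u)` in `ℝ^d ∖ 0`. -/
def SigmaSet {M : KomatsuSeq} {d : ℕ} (q : ℝ≥0∞) (ω : Rd d × Rd d → ℝ) (x : Rd d)
    (u : CompactUltradistribution M d) : Set (Rd d) :=
  {ξ | ξ ≠ 0 ∧ ξ ∉ ThetaSet q ω x u}

/-- The wave-front set `WF_𝓑(f)`, `𝓑 = 𝓕L^q_{(ω)}`, of `f ∈ (𝓓^{(M_p)})'(X)`: the pairs
`(x₀, ξ₀) ∈ X × (ℝ^d ∖ 0)` such that `ξ₀ ∈ Σ_𝓑(φ f)` for every `φ ∈ 𝓓^{(M_p)}(X)` with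
`φ(x₀) ≠ 0`. The seminorms are computed with the frozen weight `ω(x, ·)`. -/
def WF {M : KomatsuSeq} {d : ℕ} {X : Set (Rd d)} (q : ℝ≥0∞) (ω : Rd d × Rd d → ℝ) (x : Rd d)
    (f : Ultradistribution M X) : Set (Rd d × Rd d) :=
  {p | p.1 ∈ X ∧ p.2 ≠ 0 ∧ ∀ φ : BeurlingD M X, (φ : Rd d → ℂ) p.1 ≠ 0 →
    p.2 ∈ SigmaSet q ω x (f.cutoff φ)}

end

end UltraWF

/-!
Write `û` for the Fourier transform of a compactly supported ultradistribution `u`. Everything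
reduces to one local estimate, `exists_cone_eLpNorm_lt_top`: if `û ϑ(y, ·)` is in `L^r` on an open
cone `Γ₀` around `ξ₀` and `φ` is a test function, then the transform of `φ u`, multiplied by
`ω(x, ·)`, is in `L^q` on a smaller open cone around `ξ₀`. No division by a localizer is needed:
if `χ` localizes `f` with a finite seminorm, take `u = χ f`. Then `χ (φ f) = φ u` settles the
inclusions for `φ f`, and `χ² f = χ u`, with `χ²` again nonzero at the base point, settles the
monotonicity in exponent and weight.

For the estimate, the transform of `φ u` is the convolution of the transform of `φ` with `û`
(`CompactUltradistribution.toLin_mul_expFun`). To see this, the seminorm bounding `u` maps the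
ultradifferentiable functions isometrically to a space of bounded families (`jet`), to which `u`
extends by Hahn–Banach, and the Fourier inversion formula becomes a Bochner integral in that space. By (M.2)
the transform of `φ` decays faster than any product of powers of `e^{M(a|ξ|)}` and polynomials
grows, while `û` and the weights grow at most like `e^{M(τ|ξ|)}`. For `ξ` in the smaller cone the
frequencies `η ∈ Γ₀` contribute at most the convolution of an `L^r` function with a bounded
integrable kernel, which is in `L^q` for all `q ≥ r` by a special case of Young's inequality
(`eLpNorm_convolution_lt_top`). For `η ∉ Γ₀` the distance `|ξ - η|` dominates both `|ξ|` and `|η|`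
(`IsOpenCone.exists_subcone`), so the decay of the transform of `φ` absorbs all growth
(`exists_integrand_le`).

The change of the point `x` costs only a constant, by moderateness. The slice `ω(x, ·)` of a
weight need not be measurable, so `ϑ(y, ·)` is replaced by an equivalent step function
(`IsModerateWeight.exists_measurable_equiv`).
-/

namespace UltraWF

open scoped FourierTransform

/-! ### The exponential of the associated function -/

/-- The function `ρ ↦ e^{M(ρ)}`; for `ρ ≥ 0` it is the smallest `B` with `ρ ^ n ≤ M_n B` for
all `n`. -/
noncomputable def KomatsuSeq.expAssoc (M : KomatsuSeq) (ρ : ℝ) : ℝ := Real.exp (M.assoc ρ)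

namespace KomatsuSeq

variable (M : KomatsuSeq)

lemma expAssoc_pos (ρ : ℝ) : 0 < M.expAssoc ρ := Real.exp_pos _

lemma bddAbove_posLog {ρ : ℝ} (hρ : 0 ≤ ρ) :
    BddAbove (range fun p : ℕ => Real.posLog (ρ ^ p * M.seq 0 / M.seq p)) := by
  obtain ⟨C, hC⟩ := M.exists_pow_le ρ
  refine ⟨Real.posLog C, ?_⟩
  rintro _ ⟨p, rfl⟩
  have hp := M.pos p
  have h0 := M.pos 0
  refine Real.posLog_le_posLog (by positivity) ?_
  rw [M.zero_eq_one, mul_one, div_le_iff₀ hp, mul_comm]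
  exact hC p

lemma pow_le_expAssoc {ρ : ℝ} (hρ : 0 ≤ ρ) (n : ℕ) : ρ ^ n ≤ M.seq n * M.expAssoc ρ := by
  have hn := M.pos n
  have h1 : Real.posLog (ρ ^ n * M.seq 0 / M.seq n) ≤ M.assoc ρ :=
    le_ciSup (M.bddAbove_posLog hρ) n
  rw [M.zero_eq_one, mul_one] at h1
  have h2 : ρ ^ n / M.seq n ≤ Real.exp (M.assoc ρ) :=
    (Real.le_exp_log _).trans (Real.exp_le_exp.2 ((le_max_right _ _).trans h1))
  rw [div_le_iff₀ hn, mul_comm] at h2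
  exact h2

lemma expAssoc_le {ρ B : ℝ} (hρ : 0 ≤ ρ) (h : ∀ n, ρ ^ n ≤ M.seq n * B) : M.expAssoc ρ ≤ B := by
  have hB : 1 ≤ B := by simpa [M.zero_eq_one] using h 0
  refine (Real.le_log_iff_exp_le (by linarith)).1 (ciSup_le fun n => ?_)
  have hn := M.pos n
  refine (Real.posLog_le_posLog (by have := M.pos 0; positivity) (y := B) ?_).trans ?_
  · rw [M.zero_eq_one, mul_one, div_le_iff₀ hn, mul_comm]
    exact h n
  · rw [Real.posLog_eq_log (by rw [abs_of_nonneg] <;> linarith)]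

lemma one_le_expAssoc {ρ : ℝ} (hρ : 0 ≤ ρ) : 1 ≤ M.expAssoc ρ := by
  simpa [M.zero_eq_one] using M.pow_le_expAssoc hρ 0

lemma expAssoc_mono {ρ σ : ℝ} (hρ : 0 ≤ ρ) (h : ρ ≤ σ) : M.expAssoc ρ ≤ M.expAssoc σ :=
  M.expAssoc_le hρ fun n =>
    (pow_le_pow_left₀ hρ h n).trans (M.pow_le_expAssoc (hρ.trans h) n)

/-- Condition (M.2) in terms of the associated function: `2 M(ρ) ≤ M(Hρ) + ln A`. -/
lemma exists_expAssoc_sq_le : ∃ C H : ℝ, 0 < C ∧ 1 ≤ H ∧ ∀ ρ, 0 ≤ ρ →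
    M.expAssoc ρ ^ 2 ≤ C * M.expAssoc (H * ρ) := by
  obtain ⟨A, H, hA, hH, h2⟩ := M.m2
  refine ⟨A, max H 1, hA, le_max_right _ _, fun ρ hρ => ?_⟩
  -- (M.2) bounds each product of terms of the two suprema; they are taken one after the other
  have hpq : ∀ p q, ρ ^ p * ρ ^ q ≤ M.seq p * M.seq q * (A * M.expAssoc (H * ρ)) := by
    intro p q
    have h3 := M.pow_le_expAssoc (by positivity : 0 ≤ H * ρ) (p + q)
    have h4 := mul_le_mul_of_nonneg_right (h2 p q) (M.expAssoc_pos (H * ρ)).le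
    rw [mul_pow] at h3
    have h5 : H ^ (p + q) * ρ ^ (p + q) ≤
        H ^ (p + q) * (M.seq p * M.seq q * (A * M.expAssoc (H * ρ))) := by
      refine h3.trans (h4.trans (le_of_eq ?_))
      ring
    rw [← pow_add]
    exact le_of_mul_le_mul_left h5 (by positivity)
  have hE := M.expAssoc_pos (H * ρ)
  have hq : ∀ q, ρ ^ q ≤ M.seq q * (A * M.expAssoc (H * ρ) / M.expAssoc ρ) := by
    intro q
    have hMq := M.pos q
    rcases (pow_nonneg hρ q).eq_or_lt with h0 | h0
    · rw [← h0]
      have := M.expAssoc_pos ρ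
      positivity
    · have := M.expAssoc_le (B := M.seq q * (A * M.expAssoc (H * ρ)) / ρ ^ q) hρ fun p => by
        rw [← mul_div_assoc, le_div_iff₀ h0]
        exact (hpq p q).trans (le_of_eq (by ring))
      rw [le_div_iff₀ h0] at this
      rw [← mul_div_assoc, le_div_iff₀ (M.expAssoc_pos _)]
      linarith
  have h6 := M.expAssoc_le hρ hq
  rw [le_div_iff₀ (M.expAssoc_pos _)] at h6
  have h7 : M.expAssoc (H * ρ) ≤ M.expAssoc (max H 1 * ρ) :=
    M.expAssoc_mono (by positivity) (by gcongr; exact le_max_left _ _)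
  rw [sq]
  exact h6.trans (by gcongr)

lemma exists_expAssoc_pow_le (k : ℕ) : ∃ C b : ℝ, 0 < C ∧ 1 ≤ b ∧ ∀ ρ, 0 ≤ ρ →
    M.expAssoc ρ ^ k ≤ C * M.expAssoc (b * ρ) := by
  induction k with
  | zero =>
    exact ⟨1, 1, one_pos, le_rfl, fun ρ hρ => by simpa using M.one_le_expAssoc hρ⟩
  | succ k ih =>
    obtain ⟨C, b, hC, hb, h⟩ := ih
    obtain ⟨C', H, hC', hH, h'⟩ := M.exists_expAssoc_sq_le
    refine ⟨C * C', H * b, by positivity, one_le_mul_of_one_le_of_one_le hH hb, fun ρ hρ => ?_⟩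
    have h1 : M.expAssoc ρ ≤ M.expAssoc (b * ρ) :=
      M.expAssoc_mono hρ (le_mul_of_one_le_left hρ hb)
    have h0 := M.expAssoc_pos ρ
    have h2 := M.expAssoc_pos (b * ρ)
    calc M.expAssoc ρ ^ (k + 1) = M.expAssoc ρ ^ k * M.expAssoc ρ := pow_succ _ _
      _ ≤ C * M.expAssoc (b * ρ) * M.expAssoc (b * ρ) :=
        mul_le_mul (h ρ hρ) h1 h0.le (by positivity)
      _ = C * M.expAssoc (b * ρ) ^ 2 := by ring
      _ ≤ C * (C' * M.expAssoc (H * (b * ρ))) := by gcongr; exact h' _ (by positivity)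
      _ = C * C' * M.expAssoc (H * b * ρ) := by rw [mul_assoc H]; ring

lemma exists_one_add_pow_le (m : ℕ) : ∃ C : ℝ, 0 < C ∧ ∀ ρ, 0 ≤ ρ →
    (1 + ρ) ^ m ≤ C * M.expAssoc ρ := by
  have hm := M.pos m
  refine ⟨2 ^ (m - 1) * (1 + M.seq m), by positivity, fun ρ hρ => ?_⟩
  refine (add_pow_le zero_le_one hρ m).trans ?_
  rw [mul_assoc, add_mul, one_pow, one_mul]
  gcongr
  · exact M.one_le_expAssoc hρ
  · exact M.pow_le_expAssoc hρ m

/-- Powers of `e^{M(aρ)}` and polynomials are absorbed by a single `e^{M(bρ)}`. -/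
lemma exists_expAssoc_pow_mul_le {a : ℝ} (ha : 0 ≤ a) (k m : ℕ) :
    ∃ C b : ℝ, 0 < C ∧ 1 ≤ b ∧ ∀ ρ, 0 ≤ ρ →
      M.expAssoc (a * ρ) ^ k * (1 + ρ) ^ m ≤ C * M.expAssoc (b * ρ) := by
  obtain ⟨C, b, hC, hb, h⟩ := M.exists_expAssoc_pow_le (k + 1)
  obtain ⟨C', hC', h'⟩ := M.exists_one_add_pow_le m
  have ha1 : 1 ≤ max a 1 := le_max_right _ _
  refine ⟨C' * C, b * max a 1, by positivity, one_le_mul_of_one_le_of_one_le hb ha1,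
    fun ρ hρ => ?_⟩
  have h1 : M.expAssoc (a * ρ) ≤ M.expAssoc (max a 1 * ρ) :=
    M.expAssoc_mono (by positivity) (by gcongr; exact le_max_left _ _)
  have h2 : M.expAssoc ρ ≤ M.expAssoc (max a 1 * ρ) :=
    M.expAssoc_mono hρ (le_mul_of_one_le_left hρ ha1)
  have h0 := M.expAssoc_pos (a * ρ)
  have h3 := M.expAssoc_pos (max a 1 * ρ)
  calc M.expAssoc (a * ρ) ^ k * (1 + ρ) ^ m
      ≤ M.expAssoc (max a 1 * ρ) ^ k * (C' * M.expAssoc (max a 1 * ρ)) := by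
        gcongr
        exact (h' ρ hρ).trans (by gcongr)
    _ = C' * M.expAssoc (max a 1 * ρ) ^ (k + 1) := by ring
    _ ≤ C' * (C * M.expAssoc (b * (max a 1 * ρ))) := by gcongr; exact h _ (by positivity)
    _ = C' * C * M.expAssoc (b * max a 1 * ρ) := by rw [mul_assoc b]; ring

end KomatsuSeq

/-! ### Fourier transforms of test functions -/

lemma BeurlingD.integrable_iteratedFDeriv {M : KomatsuSeq} {d : ℕ} {X : Set (Rd d)}
    {ψ : Rd d → ℂ} (hψ : ψ ∈ BeurlingD M X) (n : ℕ) : Integrable (iteratedFDeriv ℝ n ψ) :=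
  (hψ.1.1.continuous_iteratedFDeriv (by exact_mod_cast le_top)).integrable_of_hasCompactSupport
    (hψ.2.1.iteratedFDeriv n)

lemma BeurlingD.integrable {M : KomatsuSeq} {d : ℕ} {X : Set (Rd d)}
    {ψ : Rd d → ℂ} (hψ : ψ ∈ BeurlingD M X) : Integrable ψ :=
  hψ.1.1.continuous.integrable_of_hasCompactSupport hψ.2.1

/-- The Fourier transform of a test function is `O(e^{-M(λ|ξ|)})` for every `λ`. -/
lemma BeurlingD.exists_norm_fourier_mul_expAssoc_le {M : KomatsuSeq} {d : ℕ} {X : Set (Rd d)}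
    {ψ : Rd d → ℂ} (hψ : ψ ∈ BeurlingD M X) {a : ℝ} (ha : 0 < a) :
    ∃ C : ℝ, 0 ≤ C ∧ ∀ ξ : Rd d, ‖𝓕 ψ ξ‖ * M.expAssoc (a * ‖ξ‖) ≤ C := by
  have hK : IsCompact (tsupport ψ) := hψ.2.1
  have hfin := hψ.1.2 _ hK ((d + 1) * a) (by positivity)
  set S := (ultraNorm M ((d + 1) * a) (tsupport ψ) ψ).toReal with hS
  have hS0 : 0 ≤ S := ENNReal.toReal_nonneg
  set V := volume.real (tsupport ψ) with hV
  have hV0 : 0 ≤ V := measureReal_nonneg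
  have hint : ∀ n, ∫ x, ‖iteratedFDeriv ℝ n ψ x‖ ≤ M.seq n / a ^ n * S * V := by
    intro n
    have hsupp : Function.support (iteratedFDeriv ℝ n ψ) ⊆ tsupport ψ :=
      support_iteratedFDeriv_subset n
    rw [← setIntegral_eq_integral_of_forall_compl_eq_zero (s := tsupport ψ) fun x hx => by
      rw [Function.notMem_support.1 fun h => hx (hsupp h), norm_zero]]
    refine (Real.le_norm_self _).trans
      (norm_setIntegral_le_of_norm_le_const hK.measure_lt_top fun x hx => ?_)
    rw [norm_norm]
    exact norm_iteratedFDeriv_le_ultraNorm M ha hfin n hx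
  have hpow : ∀ n ξ, ‖ξ‖ ^ n * ‖𝓕 ψ ξ‖ ≤ M.seq n / a ^ n * S * V := by
    intro n ξ
    have h1 := congrFun (Real.fourier_iteratedFDeriv (N := ⊤) (n := n)
      hψ.1.1 (fun n _ => BeurlingD.integrable_iteratedFDeriv hψ n) le_top) ξ
    have h2 : ‖𝓕 (iteratedFDeriv ℝ n ψ) ξ‖ ≤ M.seq n / a ^ n * S * V :=
      (VectorFourier.norm_fourierIntegral_le_integral_norm _ _ _ _ _).trans (hint n)
    rw [h1] at h2
    -- evaluating at the unit vector in the direction of `ξ` recovers the factor `‖ξ‖ ^ n`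
    have hu : ‖‖ξ‖⁻¹ • ξ‖ ≤ 1 := by
      rw [norm_smul, norm_inv, norm_norm]
      exact inv_mul_le_one
    have hin : innerSL ℝ ξ (‖ξ‖⁻¹ • ξ) = ‖ξ‖ := by
      rw [innerSL_apply_apply, real_inner_smul_right, real_inner_self_eq_norm_sq, sq, ← mul_assoc]
      by_cases h : ‖ξ‖ = 0 <;> simp [h]
    have h3 := (ContinuousMultilinearMap.unit_le_opNorm _ (m := fun _ : Fin n => ‖ξ‖⁻¹ • ξ)
      ((pi_norm_le_iff_of_nonneg zero_le_one).2 fun _ => hu)).trans h2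
    rw [VectorFourier.fourierPowSMulRight_apply] at h3
    simp only [neg_apply, hin, Finset.prod_const,
      Finset.card_univ, Fintype.card_fin, norm_smul, norm_pow, norm_neg, norm_mul,
      Complex.norm_I, Complex.norm_real, norm_norm, mul_one] at h3
    refine le_trans (le_mul_of_one_le_left (by positivity) (one_le_pow₀ ?_)) h3
    rw [Complex.norm_ofNat, Real.norm_of_nonneg Real.pi_nonneg]
    linarith [Real.pi_gt_three]
  refine ⟨S * V, by positivity, fun ξ => ?_⟩
  rcases (norm_nonneg (𝓕 ψ ξ)).eq_or_lt with h0 | h0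
  · rw [← h0, zero_mul]
    positivity
  · rw [← le_div_iff₀' h0]
    refine M.expAssoc_le (by positivity) fun n => ?_
    rw [← mul_div_assoc, le_div_iff₀ h0, mul_pow, mul_assoc]
    calc a ^ n * (‖ξ‖ ^ n * ‖𝓕 ψ ξ‖) ≤ a ^ n * (M.seq n / a ^ n * S * V) :=
          mul_le_mul_of_nonneg_left (hpow n ξ) (by positivity)
      _ = M.seq n * (S * V) := by field_simp

/-- The Fourier transform of a test function absorbs powers of `e^{M(a|ξ|)}` and polynomials. -/
lemma BeurlingD.exists_norm_fourier_mul_le {M : KomatsuSeq} {d : ℕ} {X : Set (Rd d)}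
    {ψ : Rd d → ℂ} (hψ : ψ ∈ BeurlingD M X) {a : ℝ} (ha : 0 ≤ a) (k m : ℕ) :
    ∃ C : ℝ, 0 ≤ C ∧ ∀ ξ : Rd d, ‖𝓕 ψ ξ‖ * M.expAssoc (a * ‖ξ‖) ^ k * (1 + ‖ξ‖) ^ m ≤ C := by
  obtain ⟨C, b, hC, hb, h⟩ := M.exists_expAssoc_pow_mul_le ha k m
  obtain ⟨C', hC', h'⟩ := BeurlingD.exists_norm_fourier_mul_expAssoc_le hψ
    (zero_lt_one.trans_le hb)
  refine ⟨C * C', by positivity, fun ξ => ?_⟩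
  calc ‖𝓕 ψ ξ‖ * M.expAssoc (a * ‖ξ‖) ^ k * (1 + ‖ξ‖) ^ m
      ≤ ‖𝓕 ψ ξ‖ * (C * M.expAssoc (b * ‖ξ‖)) := by
        rw [mul_assoc]
        exact mul_le_mul_of_nonneg_left (h ‖ξ‖ (norm_nonneg ξ)) (norm_nonneg _)
    _ = C * (‖𝓕 ψ ξ‖ * M.expAssoc (b * ‖ξ‖)) := by ring
    _ ≤ C * C' := by gcongr; exact h' ξ

/-- The integrable function `(1 + |ξ|)^{-(d+1)}` on `ℝ^d`. -/
noncomputable def japaneseKernel {d : ℕ} (ξ : Rd d) : ℝ := ((1 + ‖ξ‖) ^ (d + 1))⁻¹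

lemma japaneseKernel_pos {d : ℕ} (ξ : Rd d) : 0 < japaneseKernel ξ := by
  unfold japaneseKernel; positivity

lemma japaneseKernel_le_one {d : ℕ} (ξ : Rd d) : japaneseKernel ξ ≤ 1 :=
  inv_le_one_of_one_le₀ (one_le_pow₀ (by linarith [norm_nonneg ξ]))

lemma continuous_japaneseKernel {d : ℕ} : Continuous (japaneseKernel (d := d)) :=
  Continuous.inv₀ (f := fun ξ : Rd d => (1 + ‖ξ‖) ^ (d + 1)) (by fun_prop)
    fun ξ : Rd d => (by positivity : (1 + ‖ξ‖) ^ (d + 1) ≠ 0)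

lemma integrable_japaneseKernel {d : ℕ} : Integrable (japaneseKernel (d := d)) := by
  refine (integrable_one_add_norm (E := Rd d) (r := (d + 1 : ℕ)) (by simp)).congr
    (Eventually.of_forall fun ξ => ?_)
  simp only [japaneseKernel]
  rw [Real.rpow_neg (by positivity), Real.rpow_natCast]

lemma japaneseKernel_neg {d : ℕ} (ξ : Rd d) : japaneseKernel (-ξ) = japaneseKernel ξ := by
  simp [japaneseKernel]

lemma BeurlingD.exists_norm_fourier_le_japaneseKernel {M : KomatsuSeq} {d : ℕ} {X : Set (Rd d)}
    {ψ : Rd d → ℂ} (hψ : ψ ∈ BeurlingD M X) {a : ℝ} (ha : 0 ≤ a) (k m : ℕ) :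
    ∃ C : ℝ, 0 ≤ C ∧ ∀ ξ : Rd d, ‖𝓕 ψ ξ‖ * M.expAssoc (a * ‖ξ‖) ^ k ≤ C * japaneseKernel ξ ^ m := by
  obtain ⟨C, hC, h⟩ := BeurlingD.exists_norm_fourier_mul_le hψ ha k ((d + 1) * m)
  refine ⟨C, hC, fun ξ => ?_⟩
  rw [japaneseKernel, inv_pow, ← pow_mul, ← div_eq_mul_inv, le_div_iff₀ (by positivity)]
  exact h ξ

lemma BeurlingD.continuous_fourier {M : KomatsuSeq} {d : ℕ} {X : Set (Rd d)}
    {ψ : Rd d → ℂ} (hψ : ψ ∈ BeurlingD M X) : Continuous (𝓕 ψ) :=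
  VectorFourier.fourierIntegral_continuous Real.continuous_fourierChar
    (by exact continuous_inner) (BeurlingD.integrable hψ)

/-- The inverse Fourier transform of a test function is integrable against every function
of growth `O(e^{M(a|ξ|)})`. -/
lemma BeurlingD.integrable_fourierInv_smul {M : KomatsuSeq} {d : ℕ} {X : Set (Rd d)}
    {ψ : Rd d → ℂ} (hψ : ψ ∈ BeurlingD M X) {E : Type*} [NormedAddCommGroup E] [NormedSpace ℂ E]
    {g : Rd d → E} (hg : Continuous g) {a B : ℝ} (ha : 0 ≤ a)
    (h : ∀ η, ‖g η‖ ≤ B * M.expAssoc (a * ‖η‖)) : Integrable fun η => 𝓕⁻ ψ η • g η := by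
  obtain ⟨C, hC, h'⟩ := BeurlingD.exists_norm_fourier_le_japaneseKernel hψ ha 1 1
  have hB : 0 ≤ B :=
    nonneg_of_mul_nonneg_left ((norm_nonneg _).trans (h 0)) (M.expAssoc_pos _)
  have hcont : Continuous (𝓕⁻ ψ) := by
    rw [funext (Real.fourierInv_eq_fourier_neg ψ)]
    exact (BeurlingD.continuous_fourier hψ).comp continuous_neg
  refine (integrable_japaneseKernel.const_mul (B * C)).mono'
    (hcont.smul hg).aestronglyMeasurable (Eventually.of_forall fun η => ?_)
  have h1 := h' (-η)
  rw [norm_neg, japaneseKernel_neg, pow_one, pow_one, ← Real.fourierInv_eq_fourier_neg] at h1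
  rw [norm_smul]
  calc ‖𝓕⁻ ψ η‖ * ‖g η‖ ≤ ‖𝓕⁻ ψ η‖ * (B * M.expAssoc (a * ‖η‖)) :=
        mul_le_mul_of_nonneg_left (h η) (norm_nonneg _)
    _ = B * (‖𝓕⁻ ψ η‖ * M.expAssoc (a * ‖η‖)) := by ring
    _ ≤ B * (C * japaneseKernel η) := mul_le_mul_of_nonneg_left h1 hB
    _ = B * C * japaneseKernel η := by ring

lemma BeurlingD.integrable_fourierInv {M : KomatsuSeq} {d : ℕ} {X : Set (Rd d)}
    {ψ : Rd d → ℂ} (hψ : ψ ∈ BeurlingD M X) : Integrable (𝓕⁻ ψ) := by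
  have h := BeurlingD.integrable_fourierInv_smul hψ (g := fun _ => (1 : ℂ)) continuous_const
    (a := 0) (B := 1) le_rfl fun η => by
      rw [norm_one, one_mul]
      exact M.one_le_expAssoc (by positivity)
  simpa using h

/-! ### Compactly supported ultradistributions and exponentials -/

lemma norm_neg_two_pi_smul_innerSL {d : ℕ} (ξ : Rd d) :
    ‖(-2 * Real.pi) • innerSL ℝ ξ‖ = 2 * Real.pi * ‖ξ‖ := by
  rw [norm_smul, innerSL_apply_norm, Real.norm_eq_abs, abs_mul, abs_neg, abs_two,
    abs_of_pos Real.pi_pos]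

lemma ultraNorm_expFun_le {d : ℕ} (M : KomatsuSeq) {A : ℝ} (hA : 0 < A) (K : Set (Rd d))
    (ξ : Rd d) :
    ultraNorm M A K (expFun ξ) ≤ ENNReal.ofReal (M.expAssoc (2 * Real.pi * A * ‖ξ‖)) := by
  have := Real.pi_pos
  refine ultraNorm_le_of_iteratedFDeriv M hA fun n x _ => ?_
  refine (norm_iteratedFDeriv_expFun_le ξ n x).trans ?_
  rw [norm_neg_two_pi_smul_innerSL, div_mul_eq_mul_div, le_div_iff₀ (by positivity), ← mul_pow,
    mul_right_comm]
  exact M.pow_le_expAssoc (by positivity) n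

lemma expFun_add {d : ℕ} (ξ η : Rd d) : expFun (ξ + η) = expFun ξ * expFun η := by
  funext x
  simp only [expFun, Pi.mul_apply, ← Complex.exp_add, inner_add_right]
  congr 1
  push_cast
  ring

lemma norm_expFun_sub_one_le {d : ℕ} (ξ x : Rd d) :
    ‖expFun ξ x - 1‖ ≤ 2 * Real.pi * ‖x‖ * ‖ξ‖ := by
  have h := Real.norm_exp_I_mul_ofReal_sub_one_le (x := -2 * Real.pi * inner ℝ x ξ)
  rw [mul_comm Complex.I] at h
  refine h.trans ?_
  rw [norm_mul, norm_mul, norm_neg, Real.norm_ofNat, Real.norm_of_nonneg Real.pi_nonneg,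
    mul_assoc _ ‖x‖]
  have := Real.pi_pos
  gcongr
  exact norm_inner_le_norm x ξ

lemma ultraNorm_expFun_sub_one_le {d : ℕ} (M : KomatsuSeq) {A : ℝ} (hA : 0 < A) {K : Set (Rd d)}
    (hK : IsCompact K) :
    ∃ C : ℝ, 0 ≤ C ∧ ∀ ξ : Rd d, ‖ξ‖ ≤ 1 →
      ultraNorm M A K (expFun ξ - 1) ≤ ENNReal.ofReal (C * ‖ξ‖) := by
  have hpi := Real.pi_pos
  obtain ⟨R, hR⟩ := hK.isBounded.exists_norm_le
  have hE := M.expAssoc_pos (2 * Real.pi * A)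
  refine ⟨2 * Real.pi * |R| + M.expAssoc (2 * Real.pi * A), by positivity, fun ξ hξ => ?_⟩
  refine ultraNorm_le_of_iteratedFDeriv M hA fun n x hx => ?_
  have hMn := M.pos n
  rcases Nat.eq_zero_or_pos n with rfl | hn
  · rw [norm_iteratedFDeriv_zero, M.zero_eq_one, pow_zero, div_one, one_mul]
    refine (norm_expFun_sub_one_le ξ x).trans ?_
    gcongr
    have : 2 * Real.pi * ‖x‖ ≤ 2 * Real.pi * |R| := by
      gcongr
      exact (hR x hx).trans (le_abs_self R)
    linarith
  · have h1 : iteratedFDeriv ℝ n (expFun ξ - 1) x = iteratedFDeriv ℝ n (expFun ξ) x := by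
      rw [Pi.one_def, iteratedFDeriv_sub_apply ((expFun_mem M ξ).1.contDiffAt.of_le
        (by exact_mod_cast le_top)) contDiffAt_const,
        iteratedFDeriv_const_of_ne hn.ne', Pi.zero_apply, sub_zero]
    rw [h1]
    refine (norm_iteratedFDeriv_expFun_le ξ n x).trans ?_
    rw [norm_neg_two_pi_smul_innerSL, div_mul_eq_mul_div, le_div_iff₀ (by positivity)]
    have h2 : ‖ξ‖ ^ n ≤ ‖ξ‖ := pow_le_of_le_one (norm_nonneg _) hξ hn.ne'
    calc (2 * Real.pi * ‖ξ‖) ^ n * A ^ n = (2 * Real.pi * A) ^ n * ‖ξ‖ ^ n := by ring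
      _ ≤ (M.seq n * M.expAssoc (2 * Real.pi * A)) * ‖ξ‖ :=
        mul_le_mul (M.pow_le_expAssoc (by positivity) n) h2 (by positivity) (by positivity)
      _ ≤ _ := by
        rw [mul_assoc]
        gcongr
        linarith [show 0 ≤ 2 * Real.pi * |R| by positivity]

/-- Exponentials depend continuously on the frequency, in each of the norms `ultraNorm M A K`. -/
lemma tendsto_ultraNorm_expFun_sub {d : ℕ} (M : KomatsuSeq) {A : ℝ} (hA : 0 < A) {K : Set (Rd d)}
    (hK : IsCompact K) (ξ : Rd d) :
    Tendsto (fun η => ultraNorm M A K (expFun η - expFun ξ)) (𝓝 ξ) (𝓝 0) := by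
  have hA' : 0 < ((d : ℝ) + 1) * (2 * A) := by positivity
  obtain ⟨C, hC, h⟩ := ultraNorm_expFun_sub_one_le M hA' hK
  set B := ultraNorm M (((d : ℝ) + 1) * (2 * A)) K (expFun ξ) with hB
  have hBfin : B < ⊤ := (expFun_mem M ξ).2 K hK _ hA'
  have hlim : Tendsto (fun η : Rd d => B * ENNReal.ofReal (C * ‖η - ξ‖)) (𝓝 ξ) (𝓝 0) := by
    have h1 : Tendsto (fun η : Rd d => C * ‖η - ξ‖) (𝓝 ξ) (𝓝 0) := by
      have : Continuous fun η : Rd d => C * ‖η - ξ‖ := by fun_prop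
      simpa using this.tendsto ξ
    have h2 := ENNReal.Tendsto.const_mul (a := B) (ENNReal.tendsto_ofReal h1) (Or.inr hBfin.ne)
    simpa using h2
  refine tendsto_of_tendsto_of_tendsto_of_le_of_le' tendsto_const_nhds hlim
    (Eventually.of_forall fun _ => zero_le) ?_
  filter_upwards [Metric.closedBall_mem_nhds ξ one_pos] with η hη
  have h3 := h (η - ξ) (by rwa [← dist_eq_norm])
  -- translating in frequency reduces the claim to small frequencies
  have h4 : expFun η - expFun ξ = expFun ξ * (expFun (η - ξ) - 1) := by
    rw [mul_sub, mul_one, ← expFun_add, add_sub_cancel]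
  have hc : ContDiff ℝ (⊤ : ℕ∞) (expFun (η - ξ) - 1) := (expFun_mem M _).1.sub contDiff_const
  rw [h4]
  exact (ultraNorm_mul_le M hA K (expFun_mem M ξ).1 hc hBfin
    (h3.trans_lt ENNReal.ofReal_lt_top)).trans (by gcongr)

lemma mixedPartial_expFun {d : ℕ} (ξ : Rd d) (n : ℕ) (j : Fin n → Fin d) (x : Rd d) :
    mixedPartial (expFun ξ) n j x =
      (-(2 * Real.pi * Complex.I)) ^ n * ((∏ i, ξ (j i) : ℝ) * expFun ξ x) := by
  set L : Rd d →L[ℝ] ℝ := innerSL ℝ ξ with hL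
  let g : ℝ → ℂ := fun t => Complex.exp ((-(2 * Real.pi * Complex.I)) * t)
  have hg : ContDiff ℝ (⊤ : ℕ∞) g := by
    have : ContDiff ℝ (⊤ : ℕ∞) (fun t : ℝ => (t : ℂ)) := Complex.ofRealCLM.contDiff
    exact (contDiff_const.mul this).cexp
  have hfun : expFun ξ = g ∘ L := by
    funext y
    simp only [expFun, g, hL, Function.comp_apply, innerSL_apply_apply, real_inner_comm]
    congr 1
    push_cast
    ring
  have hit : iteratedDeriv n g = fun t => (-(2 * Real.pi * Complex.I)) ^ n * g t := by
    induction n with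
    | zero => simp
    | succ m ih =>
      rw [iteratedDeriv_succ, ih (fun i => j i.castSucc)]
      funext t
      have h1 : HasDerivAt g (g t * (-(2 * Real.pi * Complex.I))) t := by
        have h2 : HasDerivAt (fun t : ℝ => (-(2 * Real.pi * Complex.I)) * (t : ℂ))
            (-(2 * Real.pi * Complex.I) * 1) t :=
          (Complex.ofRealCLM.hasDerivAt (x := t)).const_mul _
        exact h2.cexp.congr_deriv (by simp [g])
      rw [(h1.const_mul _).deriv]
      ring
  unfold mixedPartial
  rw [hfun, ContinuousLinearMap.iteratedFDeriv_comp_right L hg x (by exact_mod_cast le_top),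
    ContinuousMultilinearMap.compContinuousLinearMap_apply,
    iteratedFDeriv_apply_eq_iteratedDeriv_mul_prod, hit]
  simp only [hL, innerSL_apply_apply, EuclideanSpace.inner_single_right, Function.comp_apply,
    Complex.real_smul]
  simp
  ring

/-! ### Fourier representation of compactly supported ultradistributions -/

/-- The index set of the partial derivatives of all orders at all points of `K`. -/
abbrev JetIndex (d : ℕ) (K : Set (Rd d)) := Σ n : ℕ, (Fin n → Fin d) × K

lemma norm_mul_mixedPartial_le (M : KomatsuSeq) {d : ℕ} {A : ℝ} (hA : 0 < A) {K : Set (Rd d)}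
    {φ : Rd d → ℂ} (hφ : ultraNorm M A K φ < ⊤) (i : JetIndex d K) :
    ‖((A ^ i.1 / M.seq i.1 : ℝ) : ℂ) * mixedPartial φ i.1 i.2.1 i.2.2‖ ≤
      (ultraNorm M A K φ).toReal := by
  have hM := M.pos i.1
  have h : ENNReal.ofReal (A ^ i.1 / M.seq i.1) * ‖mixedPartial φ i.1 i.2.1 i.2.2‖ₑ ≤
      ultraNorm M A K φ :=
    le_iSup_of_le i.1 (le_iSup_of_le i.2.1 (le_iSup₂_of_le (i.2.2 : Rd d) i.2.2.2 le_rfl))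
  have h' := ENNReal.toReal_mono hφ.ne h
  rwa [ENNReal.toReal_mul, ENNReal.toReal_ofReal (by positivity), toReal_enorm,
    ← Complex.norm_of_nonneg (r := A ^ i.1 / M.seq i.1) (by positivity), ← norm_mul] at h'

/-- The isometric map of `𝓔^{(M_p)}`, with the seminorm `ultraNorm M A K`, into the Banach
space of bounded families: `φ` is sent to the family of all `A^{|p|} / M_{|p|} ∂^p φ (x)`,
`x ∈ K`. -/
noncomputable def jet (M : KomatsuSeq) {d : ℕ} {A : ℝ} (hA : 0 < A) {K : Set (Rd d)}
    (hK : IsCompact K) : BeurlingE M d →ₗ[ℂ] lp (fun _ : JetIndex d K => ℂ) ⊤ where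
  toFun φ := ⟨fun i => (A ^ i.1 / M.seq i.1 : ℝ) * mixedPartial φ i.1 i.2.1 i.2.2, by
    refine memℓp_infty ⟨(ultraNorm M A K (φ : Rd d → ℂ)).toReal, ?_⟩
    rintro _ ⟨i, rfl⟩
    exact norm_mul_mixedPartial_le M hA (φ.2.2 K hK A hA) i⟩
  map_add' φ ψ := by
    ext i
    change _ * mixedPartial ((φ : Rd d → ℂ) + (ψ : Rd d → ℂ)) _ _ _ = _ * _ + _ * _
    rw [mixedPartial_add φ.2.1 ψ.2.1, mul_add]
  map_smul' c φ := by
    ext i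
    change _ * mixedPartial (c • (φ : Rd d → ℂ)) _ _ _ = c * (_ * _)
    rw [mixedPartial_smul φ.2.1, mul_left_comm]

lemma jet_apply (M : KomatsuSeq) {d : ℕ} {A : ℝ} (hA : 0 < A) {K : Set (Rd d)}
    (hK : IsCompact K) (φ : BeurlingE M d) (i : JetIndex d K) :
    jet M hA hK φ i = (A ^ i.1 / M.seq i.1 : ℝ) * mixedPartial φ i.1 i.2.1 i.2.2 := rfl

lemma enorm_jet (M : KomatsuSeq) {d : ℕ} {A : ℝ} (hA : 0 < A) {K : Set (Rd d)}
    (hK : IsCompact K) (φ : BeurlingE M d) : ‖jet M hA hK φ‖ₑ = ultraNorm M A K φ := by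
  have hfin := φ.2.2 K hK A hA
  refine le_antisymm ?_ (iSup_le fun n => iSup_le fun j => iSup₂_le fun x hx => ?_)
  · rw [← ofReal_norm]
    exact ENNReal.ofReal_le_of_le_toReal (lp.norm_le_of_forall_le ENNReal.toReal_nonneg
      fun i => norm_mul_mixedPartial_le M hA hfin i)
  · have hM := M.pos n
    have h := lp.norm_apply_le_norm ENNReal.top_ne_zero (jet M hA hK φ) ⟨n, j, x, hx⟩
    rw [jet_apply, norm_mul, Complex.norm_of_nonneg (by positivity)] at h
    rw [← ofReal_norm, ← ofReal_norm, ← ENNReal.ofReal_mul (by positivity)]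
    exact ENNReal.ofReal_le_ofReal h

lemma continuous_jet_expFun (M : KomatsuSeq) {d : ℕ} {A : ℝ} (hA : 0 < A) {K : Set (Rd d)}
    (hK : IsCompact K) : Continuous fun ξ : Rd d => jet M hA hK ⟨expFun ξ, expFun_mem M ξ⟩ := by
  refine continuous_iff_continuousAt.2 fun ξ => ?_
  rw [ContinuousAt, tendsto_iff_edist_tendsto_0]
  refine (tendsto_ultraNorm_expFun_sub M hA hK ξ).congr fun η => ?_
  rw [edist_eq_enorm_sub, ← map_sub, enorm_jet]
  rfl

/-- By Hahn–Banach, `u` factors through a continuous functional on the space of bounded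
families. -/
lemma CompactUltradistribution.exists_clm_jet {M : KomatsuSeq} {d : ℕ}
    (u : CompactUltradistribution M d) : ∃ (A : ℝ) (hA : 0 < A) (K : Set (Rd d))
      (hK : IsCompact K) (g : lp (fun _ : JetIndex d K => ℂ) ⊤ →L[ℂ] ℂ),
      ∀ φ, g (jet M hA hK φ) = u.toLin φ := by
  obtain ⟨K, hK, A, hA, C, hC⟩ := u.cont
  set T := jet M hA hK with hT
  have hbound : ∀ φ, ‖u.toLin φ‖ ≤ C * ‖T φ‖ := fun φ => by
    have h := hC φ
    rw [← enorm_jet M hA hK, ← hT, ← ofReal_norm, ← ofReal_norm, ← ENNReal.ofReal_coe_nnreal,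
      ← ENNReal.ofReal_mul C.coe_nonneg] at h
    exact (ENNReal.ofReal_le_ofReal_iff (by positivity)).1 h
  have hker : LinearMap.ker T ≤ LinearMap.ker u.toLin := fun φ hφ => by
    have h := hbound φ
    rw [LinearMap.mem_ker.1 hφ, norm_zero, mul_zero] at h
    exact norm_le_zero_iff.1 h
  let g₀ : LinearMap.range T →ₗ[ℂ] ℂ :=
    (LinearMap.ker T).liftQ u.toLin hker ∘ₗ T.quotKerEquivRange.symm.toLinearMap
  have hg₀ : ∀ φ, g₀ ⟨T φ, LinearMap.mem_range_self T φ⟩ = u.toLin φ := fun φ => by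
    simp only [g₀, LinearMap.comp_apply, LinearEquiv.coe_coe]
    rw [show T.quotKerEquivRange.symm ⟨T φ, LinearMap.mem_range_self T φ⟩ =
      Submodule.Quotient.mk φ from (LinearEquiv.symm_apply_eq _).2 (Subtype.ext rfl)]
    rfl
  obtain ⟨g, hg, -⟩ := exists_extension_norm_eq (LinearMap.range T)
    (g₀.mkContinuous C (by rintro ⟨_, φ, rfl⟩; rw [hg₀]; exact hbound φ))
  exact ⟨A, hA, K, hK, g, fun φ => (hg ⟨T φ, LinearMap.mem_range_self T φ⟩).trans (hg₀ φ)⟩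

lemma CompactUltradistribution.continuous_fourier {M : KomatsuSeq} {d : ℕ}
    (u : CompactUltradistribution M d) : Continuous u.fourier := by
  obtain ⟨A, hA, K, hK, g, hg⟩ := u.exists_clm_jet
  refine (g.continuous.comp (continuous_jet_expFun M hA hK)).congr fun ξ => ?_
  exact hg _

/-- The Fourier transform of a compactly supported ultradistribution is `O(e^{M(τ|ξ|)})` for
some `τ`. -/
lemma CompactUltradistribution.exists_norm_fourier_le {M : KomatsuSeq} {d : ℕ}
    (u : CompactUltradistribution M d) : ∃ C τ : ℝ, 0 ≤ C ∧ 0 ≤ τ ∧ ∀ ξ : Rd d,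
      ‖u.fourier ξ‖ ≤ C * M.expAssoc (τ * ‖ξ‖) := by
  obtain ⟨K, hK, A, hA, C, hC⟩ := u.cont
  refine ⟨C, 2 * Real.pi * A, C.coe_nonneg, by have := Real.pi_pos; positivity, fun ξ => ?_⟩
  have h := (hC ⟨expFun ξ, expFun_mem M ξ⟩).trans
    (mul_le_mul_right (ultraNorm_expFun_le M hA K ξ) _)
  rw [← ofReal_norm, ← ENNReal.ofReal_coe_nnreal, ← ENNReal.ofReal_mul C.coe_nonneg] at h
  exact (ENNReal.ofReal_le_ofReal_iff (mul_nonneg C.coe_nonneg (M.expAssoc_pos _).le)).1 h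

/-- Fourier inversion, differentiated under the integral sign. -/
lemma BeurlingD.mixedPartial_eq_integral {M : KomatsuSeq} {d : ℕ} {X : Set (Rd d)}
    {ψ : Rd d → ℂ} (hψ : ψ ∈ BeurlingD M X) (n : ℕ) (j : Fin n → Fin d) (x : Rd d) :
    mixedPartial ψ n j x = ∫ η, 𝓕⁻ ψ η * mixedPartial (expFun η) n j x := by
  have hint := BeurlingD.integrable_fourierInv hψ
  have hinv : 𝓕 (𝓕⁻ ψ) = ψ := by
    have h := hint.comp_neg
    simp_rw [Real.fourierInv_eq_fourier_neg, neg_neg] at h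
    exact hψ.1.1.continuous.fourier_fourierInv_eq (BeurlingD.integrable hψ) h
  have hmom : ∀ m : ℕ, Integrable fun η => ‖η‖ ^ m * ‖𝓕⁻ ψ η‖ := by
    intro m
    have h := BeurlingD.integrable_fourierInv_smul hψ (g := fun η => ((‖η‖ ^ m : ℝ) : ℂ))
      (by fun_prop) (a := 1) (B := M.seq m) zero_le_one fun η => by
        rw [Complex.norm_of_nonneg (by positivity), one_mul]
        exact M.pow_le_expAssoc (norm_nonneg η) m
    refine h.norm.congr (Eventually.of_forall fun η => ?_)
    dsimp only
    rw [norm_smul, Complex.norm_of_nonneg (by positivity), mul_comm]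
  have h := congrFun (Real.iteratedFDeriv_fourier (N := ⊤) (n := n) (fun m _ => hmom m)
    hint.aestronglyMeasurable le_top) x
  rw [hinv] at h
  rw [mixedPartial, h, Real.fourier_continuousMultilinearMap_apply, Real.fourier_eq']
  · refine integral_congr_ae (Eventually.of_forall fun η => ?_)
    simp only [VectorFourier.fourierPowSMulRight_apply, mixedPartial_expFun, expFun]
    have hcoord : ∀ i, innerSL ℝ η (EuclideanSpace.single (j i) 1) = η (j i) := fun i => by
      simp [EuclideanSpace.inner_single_right]
    simp only [hcoord, Complex.real_smul, smul_eq_mul, real_inner_comm x η]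
    ring
  · exact VectorFourier.integrable_fourierPowSMulRight _ (hmom n) hint.aestronglyMeasurable

/-- The jet of a test function is the superposition of the jets of exponentials given by Fourier
inversion. -/
lemma BeurlingD.jet_eq_integral {M : KomatsuSeq} {d : ℕ} {X : Set (Rd d)}
    {ψ : Rd d → ℂ} (hψ : ψ ∈ BeurlingD M X) {A : ℝ} (hA : 0 < A) {K : Set (Rd d)}
    (hK : IsCompact K) :
    Integrable (fun η => 𝓕⁻ ψ η • jet M hA hK ⟨expFun η, expFun_mem M η⟩) ∧
    jet M hA hK ⟨ψ, hψ.1⟩ = ∫ η, 𝓕⁻ ψ η • jet M hA hK ⟨expFun η, expFun_mem M η⟩ := by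
  have hpi := Real.pi_pos
  have hint := BeurlingD.integrable_fourierInv_smul hψ (continuous_jet_expFun M hA hK)
    (a := 2 * Real.pi * A) (B := 1) (by positivity) fun η => by
      have h := (enorm_jet M hA hK ⟨expFun η, expFun_mem M η⟩).trans_le
        (ultraNorm_expFun_le M hA K η)
      rw [← ofReal_norm] at h
      rw [one_mul]
      exact (ENNReal.ofReal_le_ofReal_iff (M.expAssoc_pos _).le).1 h
  refine ⟨hint, ?_⟩
  ext i
  have h := (lp.evalCLM ℂ (fun _ : JetIndex d K => ℂ) ⊤ i).integral_comp_comm hint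
  refine Eq.trans ?_ h
  rw [jet_apply, BeurlingD.mixedPartial_eq_integral hψ, ← integral_const_mul]
  refine integral_congr_ae (Eventually.of_forall fun η => ?_)
  change _ = 𝓕⁻ ψ η * jet M hA hK ⟨expFun η, expFun_mem M η⟩ i
  rw [jet_apply]
  exact mul_left_comm _ _ _

/-- Parseval's formula for the pairing of a compactly supported ultradistribution with a test
function. -/
lemma CompactUltradistribution.toLin_eq_integral {M : KomatsuSeq} {d : ℕ} {X : Set (Rd d)}
    (u : CompactUltradistribution M d) {ψ : Rd d → ℂ} (hψ : ψ ∈ BeurlingD M X) :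
    u.toLin ⟨ψ, hψ.1⟩ = ∫ η, 𝓕⁻ ψ η * u.fourier η := by
  obtain ⟨A, hA, K, hK, g, hg⟩ := u.exists_clm_jet
  obtain ⟨hint, heq⟩ := BeurlingD.jet_eq_integral hψ hA hK
  rw [← hg, heq, ← g.integral_comp_comm hint]
  refine integral_congr_ae (Eventually.of_forall fun η => ?_)
  simp only [map_smul, hg, smul_eq_mul]
  rfl

lemma fourierInv_mul_expFun {d : ℕ} (φ : Rd d → ℂ) (ξ η : Rd d) :
    𝓕⁻ (φ * expFun ξ) η = 𝓕 φ (ξ - η) := by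
  rw [Real.fourierInv_eq', Real.fourier_eq']
  refine integral_congr_ae (Eventually.of_forall fun v => ?_)
  simp only [Pi.mul_apply, expFun, smul_eq_mul]
  rw [mul_left_comm, ← Complex.exp_add, mul_comm]
  congr 2
  rw [inner_sub_right]
  push_cast
  ring

/-- The Fourier transform turns the product with a test function into a convolution:
`(φ u)^ = φ^ * u^`. -/
lemma CompactUltradistribution.toLin_mul_expFun {M : KomatsuSeq} {d : ℕ} {X : Set (Rd d)}
    (u : CompactUltradistribution M d) (φ : BeurlingD M X) (ξ : Rd d) :
    u.toLin ⟨(φ : Rd d → ℂ) * expFun ξ, BeurlingE.mul_mem φ.2.1 (expFun_mem M ξ)⟩ =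
      ∫ η, 𝓕 (φ : Rd d → ℂ) (ξ - η) * u.fourier η := by
  rw [u.toLin_eq_integral (BeurlingD.mul_mem φ.2 (expFun_mem M ξ))]
  simp_rw [fourierInv_mul_expFun]

/-! ### Convolution with a bounded integrable kernel -/

/-- Jensen's inequality for the convolution with an integrable kernel. -/
lemma lintegral_mul_le_rpow {α : Type*} [MeasurableSpace α] {μ : Measure α} {h F : α → ℝ≥0∞}
    (hh : Measurable h) (hF : Measurable F) {r : ℝ≥0∞} (hr : 1 ≤ r) (hr' : r ≠ ⊤) :
    ∫⁻ x, h x * F x ∂μ ≤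
      (∫⁻ x, h x * F x ^ r.toReal ∂μ) ^ (1 / r.toReal) * (∫⁻ x, h x ∂μ) ^ (1 - 1 / r.toReal) := by
  -- compare the `L^1` and `L^r` norms for the finite measure with density `h`
  have h1 := eLpNorm_le_eLpNorm_mul_rpow_measure_univ (μ := μ.withDensity h) hr
    hF.aestronglyMeasurable
  rw [eLpNorm_one_eq_lintegral_enorm,
    eLpNorm_eq_lintegral_rpow_enorm_toReal (one_pos.trans_le hr).ne' hr',
    withDensity_apply _ MeasurableSet.univ, Measure.restrict_univ] at h1
  simp only [enorm_eq_self, ENNReal.toReal_one, div_one] at h1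
  rwa [lintegral_withDensity_eq_lintegral_mul _ hh hF,
    lintegral_withDensity_eq_lintegral_mul _ hh (hF.pow_const _)] at h1

/-- A special case of Young's inequality: the convolution with a bounded integrable kernel maps
`L^r` to `L^q` for all `q ≥ r`. -/
lemma eLpNorm_convolution_lt_top {G : Type*} [AddCommGroup G] [MeasurableSpace G]
    [MeasurableAdd₂ G] [MeasurableNeg G] {μ : Measure G} [SFinite μ] [μ.IsAddLeftInvariant]
    [μ.IsNegInvariant] {h F : G → ℝ≥0∞}
    (hh : Measurable h) (hh1 : ∀ x, h x ≤ 1) (hhint : ∫⁻ x, h x ∂μ < ⊤) (hF : Measurable F)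
    {r q : ℝ≥0∞} (hr : 1 ≤ r) (hrq : r ≤ q) (hFr : eLpNorm F r μ < ⊤) :
    eLpNorm (fun x => ∫⁻ y, h (x - y) * F y ∂μ) q μ < ⊤ := by
  set I := ∫⁻ x, h x ∂μ with hI
  have hIx : ∀ x, ∫⁻ y, h (x - y) ∂μ = I := fun x => lintegral_sub_left_eq_self h x
  have hhx : ∀ x, Measurable fun y => h (x - y) := fun x =>
    hh.comp (measurable_const.sub measurable_id)
  rcases eq_or_ne r ⊤ with rfl | hrtop
  · obtain rfl : q = ⊤ := top_le_iff.1 hrq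
    have hbd : ∀ x, ∫⁻ y, h (x - y) * F y ∂μ ≤ I * eLpNorm F ⊤ μ := by
      intro x
      rw [← hIx x, ← lintegral_mul_const _ (hhx x)]
      refine lintegral_mono_ae ?_
      filter_upwards [enorm_ae_le_eLpNormEssSup F μ] with y hy
      rw [eLpNorm_exponent_top]
      gcongr
      exact hy
    refine lt_of_le_of_lt ?_ (ENNReal.mul_lt_top hhint hFr)
    rw [eLpNorm_exponent_top (f := fun x => ∫⁻ y, h (x - y) * F y ∂μ)]
    exact eLpNormEssSup_le_of_ae_enorm_bound (Eventually.of_forall hbd)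
  have hr0 : r ≠ 0 := (one_pos.trans_le hr).ne'
  set ρ := r.toReal with hρ
  have hρ1 : 1 ≤ ρ := by
    rw [hρ, ← ENNReal.toReal_one]
    exact ENNReal.toReal_mono hrtop hr
  set T := ∫⁻ y, F y ^ ρ ∂μ with hT
  have hTtop : T < ⊤ := by
    have := (eLpNorm_lt_top_iff_lintegral_rpow_enorm_lt_top hr0 hrtop).1 hFr
    simpa only [enorm_eq_self] using this
  set J := I ^ (1 - 1 / ρ) with hJ
  have hJtop : J < ⊤ := ENNReal.rpow_lt_top_of_nonneg
    (sub_nonneg.2 ((div_le_one (by positivity)).2 hρ1)) hhint.ne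
  have hjensen : ∀ x, ∫⁻ y, h (x - y) * F y ∂μ ≤
      (∫⁻ y, h (x - y) * F y ^ ρ ∂μ) ^ (1 / ρ) * J := fun x => by
    have := lintegral_mul_le_rpow (hhx x) hF hr hrtop (μ := μ)
    rwa [hIx] at this
  set S := T ^ (1 / ρ) * J with hS
  have hStop : S < ⊤ :=
    ENNReal.mul_lt_top (ENNReal.rpow_lt_top_of_nonneg (by positivity) hTtop.ne) hJtop
  have hbd : ∀ x, ∫⁻ y, h (x - y) * F y ∂μ ≤ S := by
    intro x
    refine (hjensen x).trans ?_
    rw [hS]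
    gcongr ?_ ^ (1 / ρ) * J
    exact lintegral_mono fun y => mul_le_of_le_one_left zero_le (hh1 _)
  rcases eq_or_ne q ⊤ with rfl | hqtop
  · rw [eLpNorm_exponent_top]
    exact (eLpNormEssSup_le_of_ae_enorm_bound (Eventually.of_forall hbd)).trans_lt hStop
  have hq0 : q ≠ 0 := (hr0.bot_lt.trans_le hrq).ne'
  rw [eLpNorm_lt_top_iff_lintegral_rpow_enorm_lt_top hq0 hqtop]
  simp only [enorm_eq_self]
  set κ := q.toReal with hκ
  have hκρ : ρ ≤ κ := ENNReal.toReal_mono hqtop hrq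
  -- the bound by `S` accounts for the powers in excess of `ρ`
  have hpow : ∀ x, (∫⁻ y, h (x - y) * F y ∂μ) ^ κ ≤
      S ^ (κ - ρ) * J ^ ρ * ∫⁻ y, h (x - y) * F y ^ ρ ∂μ := by
    intro x
    have h1 : (∫⁻ y, h (x - y) * F y ∂μ) ^ ρ ≤ J ^ ρ * ∫⁻ y, h (x - y) * F y ^ ρ ∂μ := by
      refine (ENNReal.rpow_le_rpow (hjensen x) (by positivity)).trans (le_of_eq ?_)
      rw [ENNReal.mul_rpow_of_nonneg _ _ (by positivity), ← ENNReal.rpow_mul,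
        one_div_mul_cancel (by positivity), ENNReal.rpow_one, mul_comm]
    calc (∫⁻ y, h (x - y) * F y ∂μ) ^ κ
        = (∫⁻ y, h (x - y) * F y ∂μ) ^ (κ - ρ) * (∫⁻ y, h (x - y) * F y ∂μ) ^ ρ := by
          rw [← ENNReal.rpow_add_of_nonneg _ _ (by linarith) (by positivity), sub_add_cancel]
      _ ≤ S ^ (κ - ρ) * (J ^ ρ * ∫⁻ y, h (x - y) * F y ^ ρ ∂μ) :=
          mul_le_mul' (ENNReal.rpow_le_rpow (hbd x) (by linarith)) h1
      _ = _ := (mul_assoc _ _ _).symm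
  have hmeas : Measurable fun p : G × G => h (p.1 - p.2) * F p.2 ^ ρ :=
    (hh.comp (measurable_fst.sub measurable_snd)).mul ((hF.comp measurable_snd).pow_const _)
  have hfubini : ∫⁻ x, ∫⁻ y, h (x - y) * F y ^ ρ ∂μ ∂μ = I * T := by
    rw [lintegral_lintegral_swap hmeas.aemeasurable, hT,
      ← lintegral_const_mul _ (hF.pow_const _)]
    refine lintegral_congr fun y => ?_
    have hhy : Measurable fun x => h (x - y) := hh.comp (measurable_id.sub measurable_const)
    rw [lintegral_mul_const _ hhy, lintegral_sub_right_eq_self h y]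
  refine (lintegral_mono hpow).trans_lt ?_
  rw [lintegral_const_mul _ hmeas.lintegral_prod_right', hfubini]
  have h1 : S ^ (κ - ρ) < ⊤ := ENNReal.rpow_lt_top_of_nonneg (by linarith) hStop.ne
  have h2 : J ^ ρ < ⊤ := ENNReal.rpow_lt_top_of_nonneg (by positivity) hJtop.ne
  exact ENNReal.mul_lt_top (ENNReal.mul_lt_top h1 h2) (ENNReal.mul_lt_top hhint hTtop)

lemma eLpNorm_lt_top_of_le_one {α : Type*} [MeasurableSpace α] {μ : Measure α} {h : α → ℝ≥0∞}
    (h1 : ∀ x, h x ≤ 1) (hint : ∫⁻ x, h x ∂μ < ⊤) {q : ℝ≥0∞} (hq : 1 ≤ q) :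
    eLpNorm h q μ < ⊤ := by
  rcases eq_or_ne q ⊤ with rfl | hqtop
  · rw [eLpNorm_exponent_top]
    exact (eLpNormEssSup_le_of_ae_enorm_bound (Eventually.of_forall h1)).trans_lt
      ENNReal.one_lt_top
  · rw [eLpNorm_lt_top_iff_lintegral_rpow_enorm_lt_top (one_pos.trans_le hq).ne' hqtop]
    refine (lintegral_mono fun x => ?_).trans_lt hint
    refine ENNReal.rpow_le_self_of_le_one (h1 x) ?_
    rw [← ENNReal.toReal_one]
    exact ENNReal.toReal_mono hqtop hq

/-! ### Moderate weights -/

namespace IsModerateWeight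

variable {M : KomatsuSeq} {d : ℕ} {ω : Rd d × Rd d → ℝ}

lemma exists_le_snd (hω : IsModerateWeight M ω) : ∃ C : ℝ, 0 < C ∧ ∀ x ζ ξ : Rd d,
    ω (x, ζ + ξ) ≤ C * M.expAssoc ‖ζ‖ * ω (x, ξ) := by
  obtain ⟨C, hC, h⟩ := hω.moderate
  refine ⟨C, hC, fun x ζ ξ => ?_⟩
  simpa [KomatsuSeq.expAssoc] using h (0, ζ) (x, ξ)

lemma exists_le_fst (hω : IsModerateWeight M ω) (x y : Rd d) : ∃ C : ℝ, 0 < C ∧ ∀ ξ : Rd d,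
    ω (x, ξ) ≤ C * ω (y, ξ) := by
  obtain ⟨C, hC, h⟩ := hω.moderate
  refine ⟨C * M.expAssoc ‖x - y‖, mul_pos hC (M.expAssoc_pos _), fun ξ => ?_⟩
  simpa [KomatsuSeq.expAssoc] using h (x - y, 0) (y, ξ)

/-- A frozen moderate weight is equivalent to a measurable one, namely to its values at lattice
points. The weight itself is only measurable as a function on `ℝ^{2d}`, so its restriction to
`{y} × ℝ^d` need not be. -/
lemma exists_measurable_equiv (hω : IsModerateWeight M ω) (y : Rd d) :
    ∃ v : Rd d → ℝ, Measurable v ∧ (∀ ξ, 0 ≤ v ξ) ∧ ∃ C : ℝ, 0 < C ∧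
      (∀ ξ, v ξ ≤ C * ω (y, ξ)) ∧ ∀ ξ, ω (y, ξ) ≤ C * v ξ := by
  obtain ⟨C, hC, h⟩ := hω.exists_le_snd
  -- `p` rounds every coordinate down to an integer, so `ξ` is moved by at most `√d`
  let p : Rd d → Rd d := fun ξ => WithLp.toLp 2 fun i => (⌊ξ i⌋ : ℝ)
  have hp : ∀ ξ, ‖ξ - p ξ‖ ≤ √d := by
    intro ξ
    rw [EuclideanSpace.norm_eq]
    refine Real.sqrt_le_sqrt ((Finset.sum_le_card_nsmul _ _ 1 fun i _ => ?_).trans ?_)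
    · have h1 : (ξ - p ξ) i = Int.fract (ξ i) := by simp [p]
      rw [h1, Real.norm_of_nonneg (Int.fract_nonneg _)]
      exact pow_le_one₀ (Int.fract_nonneg _) (Int.fract_lt_one _).le
    · simp
  have hE := M.expAssoc_pos √d
  have hstep : ∀ ξ η : Rd d, ‖ξ - η‖ ≤ √d → ω (y, ξ) ≤ C * M.expAssoc √d * ω (y, η) := by
    intro ξ η hξη
    have h1 := h y (ξ - η) η
    rw [sub_add_cancel] at h1
    refine h1.trans (mul_le_mul_of_nonneg_right ?_ (hω.nonneg _))
    gcongr
    exact M.expAssoc_mono (norm_nonneg _) hξη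
  refine ⟨fun ξ => ω (y, p ξ), ?_, fun ξ => hω.nonneg _, C * M.expAssoc √d, by positivity,
    fun ξ => hstep _ _ (by rw [norm_sub_rev]; exact hp ξ), fun ξ => hstep _ _ (hp ξ)⟩
  have h1 : Measurable fun (ξ : Rd d) (i : Fin d) => ⌊ξ i⌋ :=
    measurable_pi_lambda _ fun i => Int.measurable_floor.comp (by fun_prop)
  exact (Measurable.of_discrete
    (f := fun k : Fin d → ℤ => ω (y, WithLp.toLp 2 fun i => (k i : ℝ)))).comp h1

end IsModerateWeight

/-! ### Cones -/

/-- Every open cone `Γ₀` containing `ξ₀` has an open subcone containing `ξ₀` whose elements `ξ`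
satisfy `max(|ξ|, |η|) ≤ c |ξ - η|` for all `η` outside `Γ₀`. -/
lemma IsOpenCone.exists_subcone {d : ℕ} {Γ₀ : Set (Rd d)} (hΓ₀ : IsOpenCone Γ₀) {ξ₀ : Rd d}
    (hξ₀ : ξ₀ ∈ Γ₀) : ∃ Γ : Set (Rd d), IsOpenCone Γ ∧ ξ₀ ∈ Γ ∧ ∃ c : ℝ, 0 < c ∧
      ∀ ξ ∈ Γ, ∀ η ∉ Γ₀, ‖ξ‖ ≤ c * ‖ξ - η‖ ∧ ‖η‖ ≤ c * ‖ξ - η‖ := by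
  obtain ⟨ε, hε, hball⟩ := Metric.isOpen_iff.1 hΓ₀.isOpen ξ₀ hξ₀
  -- rescaled points of the complement of `Γ₀` stay outside the ball around `ξ₀`
  have hout : ∀ η ∉ Γ₀, ∀ t : ℝ, 0 < t → ε ≤ ‖t • η - ξ₀‖ := by
    intro η hη t ht
    by_contra! hlt
    have h1 := hΓ₀.smul_mem t⁻¹ (by positivity) _ (hball (mem_ball_iff_norm.2 hlt))
    rw [inv_smul_smul₀ ht.ne'] at h1
    exact hη h1
  refine ⟨{ξ | ∃ t : ℝ, 0 < t ∧ ‖t • ξ - ξ₀‖ < ε / 2}, ⟨?_, ?_, ?_⟩,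
    ⟨1, one_pos, by simpa using hε⟩, (‖ξ₀‖ + ε / 2) / (ε / 2) + 1, by positivity, ?_⟩
  · simp only [Set.ofPred_exists, Set.ofPred_and]
    refine isOpen_iUnion fun t => isOpen_const.inter (isOpen_lt (by fun_prop) continuous_const)
  · rintro ⟨t, ht, hlt⟩
    linarith [hout 0 hΓ₀.zero_notMem t ht, hlt]
  · rintro s hs ξ ⟨t, ht, hlt⟩
    refine ⟨t / s, by positivity, ?_⟩
    rwa [smul_smul, div_mul_cancel₀ _ hs.ne']
  · rintro ξ ⟨t, ht, hlt⟩ η hη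
    have h1 : ε / 2 ≤ t * ‖ξ - η‖ := by
      have h2 : ‖t • η - ξ₀‖ ≤ ‖t • ξ - ξ₀‖ + t * ‖ξ - η‖ := by
        rw [← Real.norm_of_nonneg ht.le, ← norm_smul, Real.norm_of_nonneg ht.le, smul_sub]
        exact (norm_sub_le _ _).trans' (le_of_eq (by congr 1; abel))
      linarith [hout η hη t ht]
    have h2 : t * ‖ξ‖ ≤ ‖ξ₀‖ + ε / 2 := by
      have h3 : ‖t • ξ‖ ≤ ‖t • ξ - ξ₀‖ + ‖ξ₀‖ := by
        simpa using norm_add_le (t • ξ - ξ₀) ξ₀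
      rw [norm_smul, Real.norm_of_nonneg ht.le] at h3
      linarith
    have h3 : ‖ξ‖ ≤ (‖ξ₀‖ + ε / 2) / (ε / 2) * ‖ξ - η‖ := by
      refine le_of_mul_le_mul_left ?_ ht
      rw [div_mul_eq_mul_div, mul_div_assoc', le_div_iff₀ (by positivity)]
      nlinarith [mul_le_mul h2 h1 (by positivity) (by positivity)]
    have h4 : ‖η‖ ≤ ‖ξ‖ + ‖ξ - η‖ := by
      simpa using norm_sub_le ξ (ξ - η)
    constructor <;> linarith [norm_nonneg (ξ - η)]

/-! ### The local estimate -/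

lemma japaneseKernel_le_mul {d : ℕ} {ξ ζ : Rd d} {c : ℝ} (hc : 0 < c) (h : ‖ξ‖ ≤ c * ‖ζ‖) :
    japaneseKernel ζ ≤ (1 + c) ^ (d + 1) * japaneseKernel ξ := by
  unfold japaneseKernel
  rw [← div_eq_mul_inv, inv_eq_one_div, div_le_div_iff₀ (by positivity) (by positivity), one_mul,
    ← mul_pow]
  gcongr
  nlinarith [norm_nonneg ζ]

/-- Pointwise bound for the integrand of the convolution `φ^ * u^` on a small cone. Frequencies
`η ∈ Γ₀` contribute a convolution with the weighted transform of `u`; for the others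
`|ξ - η|` dominates `|ξ|` and `|η|`, and the decay of `φ^` beats all growth. -/
lemma exists_integrand_le {M : KomatsuSeq} {d : ℕ} {X : Set (Rd d)} (φ : BeurlingD M X)
    (u : CompactUltradistribution M d) {ω ϑ : Rd d × Rd d → ℝ} (hω : IsModerateWeight M ω)
    (hϑ : IsModerateWeight M ϑ) (hωϑ : WeightLE ω ϑ) (x y : Rd d) {v : Rd d → ℝ} {Cv : ℝ}
    (hCv : 0 < Cv) (hv0 : ∀ ξ, 0 ≤ v ξ) (hv : ∀ ξ, ϑ (y, ξ) ≤ Cv * v ξ)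
    {Γ Γ₀ : Set (Rd d)} {c : ℝ} (hc : 0 < c)
    (hΓ : ∀ ξ ∈ Γ, ∀ η ∉ Γ₀, ‖ξ‖ ≤ c * ‖ξ - η‖ ∧ ‖η‖ ≤ c * ‖ξ - η‖) :
    ∃ B : ℝ, 0 ≤ B ∧ ∀ ξ ∈ Γ, ∀ η,
      ‖𝓕 (φ : Rd d → ℂ) (ξ - η)‖ * ‖u.fourier η‖ * ω (x, ξ) ≤
        japaneseKernel (ξ - η) * Γ₀.indicator (fun η => B * (‖u.fourier η‖ * v η)) η +
          japaneseKernel (ξ - η) * (B * japaneseKernel ξ) := by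
  obtain ⟨c₁, hc₁, h₁⟩ := hωϑ
  obtain ⟨c₂, hc₂, h₂⟩ := hω.exists_le_fst x y
  obtain ⟨c₃, hc₃, h₃⟩ := hϑ.exists_le_snd
  obtain ⟨c₄, τ, hc₄, hτ, h₄⟩ := u.exists_norm_fourier_le
  obtain ⟨c₅, hc₅, h₅⟩ :=
    BeurlingD.exists_norm_fourier_le_japaneseKernel φ.2 (a := 1) zero_le_one 1 1
  have hb : 0 ≤ max c (τ * c) := hc.le.trans (le_max_left _ _)
  obtain ⟨c₆, hc₆, h₆⟩ := BeurlingD.exists_norm_fourier_le_japaneseKernel φ.2 hb 2 2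
  have hϑ0 := hϑ.nonneg (y, 0)
  have hωϑ' : ∀ ξ, ω (x, ξ) ≤ c₂ * c₁ * ϑ (y, ξ) := fun ξ => by
    rw [mul_assoc]
    exact (h₂ ξ).trans (by gcongr; exact h₁ _)
  set B₁ := c₂ * c₁ * c₃ * Cv * c₅ with hB₁
  set B₂ := c₂ * c₁ * c₃ * ϑ (y, 0) * c₄ * c₆ * (1 + c) ^ (d + 1) with hB₂
  have hB₁0 : 0 ≤ B₁ := by positivity
  have hB₂0 : 0 ≤ B₂ := by positivity
  refine ⟨max B₁ B₂, le_max_of_le_left hB₁0, fun ξ hξ η => ?_⟩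
  have hjζ := japaneseKernel_pos (ξ - η)
  have hjξ := japaneseKernel_pos ξ
  by_cases hη : η ∈ Γ₀
  · rw [indicator_of_mem hη]
    have h7 := h₅ (ξ - η)
    rw [one_mul, pow_one, pow_one] at h7
    have h8 := h₃ y (ξ - η) η
    rw [sub_add_cancel] at h8
    have hE := M.expAssoc_pos ‖ξ - η‖
    have hvη := hv0 η
    refine le_trans ?_ (le_add_of_nonneg_right (by positivity))
    calc ‖𝓕 (φ : Rd d → ℂ) (ξ - η)‖ * ‖u.fourier η‖ * ω (x, ξ)
        ≤ ‖𝓕 (φ : Rd d → ℂ) (ξ - η)‖ * ‖u.fourier η‖ *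
            (c₂ * c₁ * (c₃ * M.expAssoc ‖ξ - η‖ * (Cv * v η))) := by
          refine mul_le_mul_of_nonneg_left ((hωϑ' ξ).trans ?_) (by positivity)
          refine mul_le_mul_of_nonneg_left (h8.trans ?_) (by positivity)
          exact mul_le_mul_of_nonneg_left (hv η) (by positivity)
      _ = (‖𝓕 (φ : Rd d → ℂ) (ξ - η)‖ * M.expAssoc ‖ξ - η‖) *
            (c₂ * c₁ * c₃ * Cv * (‖u.fourier η‖ * v η)) := by ring
      _ ≤ (c₅ * japaneseKernel (ξ - η)) * (c₂ * c₁ * c₃ * Cv * (‖u.fourier η‖ * v η)) :=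
          mul_le_mul_of_nonneg_right h7 (by positivity)
      _ = japaneseKernel (ξ - η) * (B₁ * (‖u.fourier η‖ * v η)) := by rw [hB₁]; ring
      _ ≤ _ := by gcongr; exact le_max_left _ _
  · rw [indicator_of_notMem hη, mul_zero, zero_add]
    obtain ⟨hξη, hηξ⟩ := hΓ ξ hξ η hη
    have h7 := h₆ (ξ - η)
    have h8 := h₃ y ξ 0
    rw [add_zero] at h8
    -- `E` bounds both the growth of the weight at `ξ` and that of `û` at `η`
    set E := M.expAssoc (max c (τ * c) * ‖ξ - η‖) with hE
    have hE0 : 0 < E := M.expAssoc_pos _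
    have hEξ : M.expAssoc ‖ξ‖ ≤ E := M.expAssoc_mono (norm_nonneg _)
      (hξη.trans (by gcongr; exact le_max_left _ _))
    have hEη : M.expAssoc (τ * ‖η‖) ≤ E := M.expAssoc_mono (by positivity) (by
      calc τ * ‖η‖ ≤ τ * (c * ‖ξ - η‖) := by gcongr
        _ = τ * c * ‖ξ - η‖ := by ring
        _ ≤ _ := by gcongr; exact le_max_right _ _)
    calc ‖𝓕 (φ : Rd d → ℂ) (ξ - η)‖ * ‖u.fourier η‖ * ω (x, ξ)
        ≤ ‖𝓕 (φ : Rd d → ℂ) (ξ - η)‖ * (c₄ * E) * (c₂ * c₁ * (c₃ * E * ϑ (y, 0))) := by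
          refine mul_le_mul ?_ ((hωϑ' ξ).trans ?_) (hω.nonneg _) (by positivity)
          · exact mul_le_mul_of_nonneg_left ((h₄ η).trans (by gcongr)) (norm_nonneg _)
          · refine mul_le_mul_of_nonneg_left (h8.trans ?_) (by positivity)
            gcongr
      _ = (‖𝓕 (φ : Rd d → ℂ) (ξ - η)‖ * E ^ 2) * (c₂ * c₁ * c₃ * ϑ (y, 0) * c₄) := by ring
      _ ≤ (c₆ * japaneseKernel (ξ - η) ^ 2) * (c₂ * c₁ * c₃ * ϑ (y, 0) * c₄) :=
          mul_le_mul_of_nonneg_right h7 (by positivity)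
      _ = (c₂ * c₁ * c₃ * ϑ (y, 0) * c₄ * c₆) * japaneseKernel (ξ - η) *
            japaneseKernel (ξ - η) := by ring
      _ ≤ (c₂ * c₁ * c₃ * ϑ (y, 0) * c₄ * c₆) * japaneseKernel (ξ - η) *
            ((1 + c) ^ (d + 1) * japaneseKernel ξ) :=
          mul_le_mul_of_nonneg_left (japaneseKernel_le_mul hc hξη) (by positivity)
      _ = japaneseKernel (ξ - η) * (B₂ * japaneseKernel ξ) := by rw [hB₂]; ring
      _ ≤ _ := by gcongr; exact le_max_right _ _

/-- Multiplication by a test function, passing to a larger exponent, to a smaller weight and to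
another frozen point all preserve the microlocal regularity of a compactly supported
ultradistribution at `ξ₀`. -/
lemma exists_cone_eLpNorm_lt_top {M : KomatsuSeq} {d : ℕ} {X : Set (Rd d)} (φ : BeurlingD M X)
    (u : CompactUltradistribution M d) {ω ϑ : Rd d × Rd d → ℝ} (hω : IsModerateWeight M ω)
    (hϑ : IsModerateWeight M ϑ) (hωϑ : WeightLE ω ϑ) (x y : Rd d) {q r : ℝ≥0∞} (hr : 1 ≤ r)
    (hrq : r ≤ q) {ξ₀ : Rd d} (h : ξ₀ ∈ ThetaSet r ϑ y u) :
    ∃ Γ : Set (Rd d), IsOpenCone Γ ∧ ξ₀ ∈ Γ ∧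
      eLpNorm (fun ξ => u.toLin ⟨(φ : Rd d → ℂ) * expFun ξ,
        BeurlingE.mul_mem φ.2.1 (expFun_mem M ξ)⟩ * (ω (x, ξ) : ℂ)) q (volume.restrict Γ) < ⊤ := by
  obtain ⟨-, Γ₀, hΓ₀, hξ₀, hfin⟩ := h
  obtain ⟨v, hvm, hv0, Cv, hCv, hv1, hv2⟩ := hϑ.exists_measurable_equiv y
  obtain ⟨Γ, hΓ, hξΓ, c, hc, hcone⟩ := hΓ₀.exists_subcone hξ₀
  obtain ⟨B, hB, hpt⟩ := exists_integrand_le φ u hω hϑ hωϑ x y hCv hv0 hv2 hc hcone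
  refine ⟨Γ, hΓ, hξΓ, ?_⟩
  set k : Rd d → ℝ≥0∞ := fun ζ => ENNReal.ofReal (japaneseKernel ζ) with hk
  have hkm : Measurable k := continuous_japaneseKernel.measurable.ennreal_ofReal
  have hk1 : ∀ ζ, k ζ ≤ 1 := fun ζ => ENNReal.ofReal_le_one.2 (japaneseKernel_le_one ζ)
  have hkint : ∫⁻ ζ, k ζ < ⊤ := integrable_japaneseKernel.lintegral_lt_top
  set F : Rd d → ℝ≥0∞ :=
    Γ₀.indicator fun η => ENNReal.ofReal (B * (‖u.fourier η‖ * v η)) with hF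
  have hFm : Measurable F := (((u.continuous_fourier.measurable.norm.mul hvm).const_mul
    B).ennreal_ofReal).indicator hΓ₀.isOpen.measurableSet
  have hFr : eLpNorm F r volume < ⊤ := by
    rw [hF, eLpNorm_indicator_eq_eLpNorm_restrict hΓ₀.isOpen.measurableSet]
    have hle : ∀ η, ‖ENNReal.ofReal (B * (‖u.fourier η‖ * v η))‖ₑ ≤
        ‖((B * Cv : ℝ) : ℂ) • (u.fourier η * (ϑ (y, η) : ℂ))‖ₑ := by
      intro η
      rw [enorm_eq_self, ← ofReal_norm]
      refine ENNReal.ofReal_le_ofReal ?_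
      rw [norm_smul, norm_mul, Complex.norm_of_nonneg (by positivity),
        Complex.norm_of_nonneg (hϑ.nonneg _), mul_assoc]
      refine mul_le_mul_of_nonneg_left ?_ hB
      rw [mul_left_comm]
      exact mul_le_mul_of_nonneg_left (hv1 η) (norm_nonneg _)
    refine (eLpNorm_mono_enorm hle).trans_lt ?_
    exact (eLpNorm_const_smul ((B * Cv : ℝ) : ℂ) (fun η => u.fourier η * (ϑ (y, η) : ℂ)) r
      (volume.restrict Γ₀)).trans_lt (ENNReal.mul_lt_top enorm_lt_top hfin)
  have hconv := eLpNorm_convolution_lt_top hkm hk1 hkint hFm hr hrq hFr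
  set D : ℝ≥0∞ := ENNReal.ofReal B * ∫⁻ ζ, k ζ with hD
  have hDtop : D ≠ ⊤ := (ENNReal.mul_lt_top ENNReal.ofReal_lt_top hkint).ne
  have hconvm : Measurable fun ξ => ∫⁻ η, k (ξ - η) * F η :=
    ((hkm.comp (measurable_fst.sub measurable_snd)).mul
      (hFm.comp measurable_snd)).lintegral_prod_right'
  have hbound : ∀ ξ ∈ Γ, ‖u.toLin ⟨(φ : Rd d → ℂ) * expFun ξ,
        BeurlingE.mul_mem φ.2.1 (expFun_mem M ξ)⟩ * (ω (x, ξ) : ℂ)‖ₑ ≤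
      ‖(∫⁻ η, k (ξ - η) * F η) + D * k ξ‖ₑ := by
    intro ξ hξ
    have hkξ : Measurable fun η => k (ξ - η) := hkm.comp (measurable_const.sub measurable_id)
    rw [u.toLin_mul_expFun, enorm_eq_self, ← integral_mul_const]
    refine (enorm_integral_le_lintegral_enorm _).trans ?_
    have hpt' : ∀ η, ‖𝓕 (φ : Rd d → ℂ) (ξ - η) * u.fourier η * (ω (x, ξ) : ℂ)‖ₑ ≤
        k (ξ - η) * F η + k (ξ - η) * (ENNReal.ofReal B * k ξ) := by
      intro η
      have hj := (japaneseKernel_pos (ξ - η)).le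
      have hj' := (japaneseKernel_pos ξ).le
      have hFη : F η =
          ENNReal.ofReal (Γ₀.indicator (fun η => B * (‖u.fourier η‖ * v η)) η) := by
        by_cases hη : η ∈ Γ₀ <;> simp [hF, hη]
      have hind : 0 ≤ Γ₀.indicator (fun η => B * (‖u.fourier η‖ * v η)) η :=
        indicator_nonneg (fun η _ => by have := hv0 η; positivity) η
      rw [hFη, hk, ← ENNReal.ofReal_mul hj, ← ENNReal.ofReal_mul hB, ← ENNReal.ofReal_mul hj,
        ← ENNReal.ofReal_add (by positivity) (by positivity), ← ofReal_norm, norm_mul, norm_mul,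
        Complex.norm_of_nonneg (hω.nonneg _)]
      exact ENNReal.ofReal_le_ofReal (hpt ξ hξ η)
    refine (lintegral_mono hpt').trans (le_of_eq ?_)
    have hmul : Measurable fun η => k (ξ - η) * F η := hkξ.mul hFm
    rw [lintegral_add_left hmul, lintegral_mul_const _ hkξ, lintegral_sub_left_eq_self k ξ, hD]
    ring
  refine (eLpNorm_mono_enorm_ae ((ae_restrict_iff' hΓ.isOpen.measurableSet).2
    (Eventually.of_forall hbound))).trans_lt ?_
  refine (eLpNorm_restrict_le _ _ _ _).trans_lt ?_
  refine (eLpNorm_add_le hconvm.aestronglyMeasurable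
    (hkm.const_mul _).aestronglyMeasurable (hr.trans hrq)).trans_lt ?_
  have hDk : ∀ ξ, ‖D * k ξ‖ₑ ≤ D.toNNReal * ‖k ξ‖ₑ := fun ξ => by
    rw [ENNReal.coe_toNNReal hDtop, enorm_eq_self, enorm_eq_self]
  refine ENNReal.add_lt_top.2 ⟨hconv, (eLpNorm_le_nnreal_smul_eLpNorm_of_ae_le_mul'
    (Eventually.of_forall hDk) q).trans_lt ?_⟩
  exact ENNReal.mul_lt_top ENNReal.coe_lt_top
    (eLpNorm_lt_top_of_le_one hk1 hkint (hr.trans hrq))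

lemma Ultradistribution.fourier_cutoff_mulTest {M : KomatsuSeq} {d : ℕ} {X : Set (Rd d)}
    (f : Ultradistribution M X) (φ χ : BeurlingD M X) (ξ : Rd d) :
    ((f.mulTest φ).cutoff χ).fourier ξ = (f.cutoff χ).toLin ⟨(φ : Rd d → ℂ) * expFun ξ,
      BeurlingE.mul_mem φ.2.1 (expFun_mem M ξ)⟩ :=
  congrArg f.toLin (Subtype.ext (mul_left_comm _ _ _))

lemma Ultradistribution.fourier_cutoff_mul {M : KomatsuSeq} {d : ℕ} {X : Set (Rd d)}
    (f : Ultradistribution M X) (χ ψ : BeurlingD M X) (ξ : Rd d) :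
    (f.cutoff ⟨(χ : Rd d → ℂ) * (ψ : Rd d → ℂ), BeurlingD.mul_mem χ.2 ψ.2.1⟩).fourier ξ =
      (f.cutoff χ).toLin ⟨(ψ : Rd d → ℂ) * expFun ξ,
        BeurlingE.mul_mem ψ.2.1 (expFun_mem M ξ)⟩ :=
  congrArg f.toLin (Subtype.ext (mul_assoc _ _ _))

/-! ### Wave-front sets -/

/-- A point outside the wave-front set of `f` stays outside when `f` is multiplied by `φ`: a
localizer `χ` that works for `f` also works for `φ f`, since `χ (φ f) = φ (χ f)`. -/
lemma WF_mulTest_subset {M : KomatsuSeq} {d : ℕ} {X : Set (Rd d)} {q r : ℝ≥0∞} (hr : 1 ≤ r)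
    (hrq : r ≤ q) {ω ϑ : Rd d × Rd d → ℝ} (hω : IsModerateWeight M ω)
    (hϑ : IsModerateWeight M ϑ) (hωϑ : WeightLE ω ϑ) (f : Ultradistribution M X)
    (φ : BeurlingD M X) (x y : Rd d) : WF q ω x (f.mulTest φ) ⊆ WF r ϑ y f := by
  rintro ⟨x₀, ξ₀⟩ ⟨hx₀, hξ₀, hwf⟩
  refine ⟨hx₀, hξ₀, fun χ hχ => ⟨hξ₀, fun hθ => (hwf χ hχ).2 ⟨hξ₀, ?_⟩⟩⟩
  simp only [flSeminorm, f.fourier_cutoff_mulTest]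
  exact exists_cone_eLpNorm_lt_top φ (f.cutoff χ) hω hϑ hωϑ x y hr hrq hθ

/-- If `χ` is a localizer that works for `f` in the space with the larger weight and the smaller
exponent, then `χ²` works in the other one. -/
lemma WF_mono {M : KomatsuSeq} {d : ℕ} {X : Set (Rd d)} {q r : ℝ≥0∞} (hr : 1 ≤ r)
    (hrq : r ≤ q) {ω ϑ : Rd d × Rd d → ℝ} (hω : IsModerateWeight M ω)
    (hϑ : IsModerateWeight M ϑ) (hωϑ : WeightLE ω ϑ) (f : Ultradistribution M X)
    (x y : Rd d) : WF q ω x f ⊆ WF r ϑ y f := by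
  rintro ⟨x₀, ξ₀⟩ ⟨hx₀, hξ₀, hwf⟩
  refine ⟨hx₀, hξ₀, fun χ hχ => ⟨hξ₀, fun hθ => ?_⟩⟩
  refine (hwf ⟨χ * χ, BeurlingD.mul_mem χ.2 χ.2.1⟩ (mul_ne_zero hχ hχ)).2 ⟨hξ₀, ?_⟩
  simp only [flSeminorm, f.fourier_cutoff_mul]
  exact exists_cone_eLpNorm_lt_top χ (f.cutoff χ) hω hϑ hωϑ x y hr hrq hθ

end UltraWF

theorem mainTheorem3 (M : UltraWF.KomatsuSeq) (d : ℕ) (X : Set (UltraWF.Rd d)) (hX : IsOpen X)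
    (q r : ℝ≥0∞) (hr : 1 ≤ r) (hrq : r ≤ q)
    (ω ϑ : UltraWF.Rd d × UltraWF.Rd d → ℝ)
    (hω : UltraWF.IsModerateWeight M ω) (hϑ : UltraWF.IsModerateWeight M ϑ)
    (hωϑ : UltraWF.WeightLE ω ϑ)
    (f : UltraWF.Ultradistribution M X) (φ : UltraWF.BeurlingD M X)
    (x y : UltraWF.Rd d) :
    UltraWF.WF q ω x (f.mulTest φ) ⊆ UltraWF.WF r ϑ y f ∧
    -- microlocality
    UltraWF.WF q ω x (f.mulTest φ) ⊆ UltraWF.WF q ω y f ∧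
    -- monotonicity in the exponent and in the weight
    UltraWF.WF q ω x f ⊆ UltraWF.WF r ω y f ∧
    UltraWF.WF q ω x f ⊆ UltraWF.WF q ϑ y f := by
  have hrefl : UltraWF.WeightLE ω ω := ⟨1, one_pos, fun z => (one_mul _).ge⟩
  exact ⟨UltraWF.WF_mulTest_subset hr hrq hω hϑ hωϑ f φ x y,
    UltraWF.WF_mulTest_subset (hr.trans hrq) le_rfl hω hω hrefl f φ x y,
    UltraWF.WF_mono hr hrq hω hω hrefl f x y,
    UltraWF.WF_mono (hr.trans hrq) le_rfl hω hϑ hωϑ f x y⟩
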